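/- Let $M,N$ be numbers of modes and of two-level systems, $\Lambda\in\mathbb{R}^{M\times N}$ and $t\in\mathbb{R}^N$ with $t\neq 0$. Let $\sigma_x^n,\sigma_z^n$ ($n=1,\dots,N$) be the Pauli matrices $\begin{pmatrix}0&1\\1&0\end{pmatrix}$, $\begin{pmatrix}1&0\\0&-1\end{pmatrix}$ acting on the $n$-th factor of $\bigotimes^N\mathbb{C}^2\simeq\mathbb{C}^{2^N}$, whose components are indexed by $\alpha\in\{+,-\}^N$. On $\mathcal{H}=L^2(\mathbb{R}^M,\mathbb{C}^{2^N})$, with inner product $\langle\cdot,\cdot\rangle$ conjugate-linear in the first argument, consider for $v\in\mathbb{R}^N$, $j\in\mathbb{R}^M$ the operators $$H_0=-\Delta+|x|^2+\sum_{m,n}\Lambda_{mn}x_m\sigma_z^n-\sum_n t_n\sigma_x^n,\qquad H(v,j)=H_0+\sum_n v_n\sigma_z^n+\sum_m j_mx_m$$ with domain $\{\psi\in\mathcal{H}:\Delta\psi\in\mathcal{H},\ |x|^2\psi\in\mathcal{H}\}$ (weak Laplacian), and let $Q_0=\{\psi\in\mathcal{H}:\partial_m\psi\in\mathcal{H},\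 x_m\psi\in\mathcal{H}\text{ for all }m\}$ be the form domain. For $\psi\in Q_0$ the quadratic forms are $$\langle\psi,H_0\psi\rangle=\|\nabla\psi\|^2+\|x\psi\|^2+\sum_{m,n}\Lambda_{mn}\langle\psi,x_m\sigma_z^n\psi\rangle-\sum_nt_n\langle\psi,\sigma_x^n\psi\rangle,$$ $$\langle\psi,H(v,j)\psi\rangle=\langle\psi,H_0\psi\rangle+v\cdot\sigma_\psi+j\cdot\xi_\psi,$$ where $\sigma_\psi=(\langle\psi,\sigma_z^n\psi\rangle)_n\in\mathbb{R}^N$ and $\xi_\psi=(\langle\psi,x_m\psi\rangle)_m\in\mathbb{R}^M$. For $\sigma\in[-1,1]^N$, $\xi\in\mathbb{R}^M$ put $$\mathcal{M}_{\sigma,\xi}=\{\psi\in Q_0:\|\psi\|=1,\ \sigma_\psi=\sigma,\ \xi_\psi=\xi\},\qquad F_{\mathrm{LL}}(\sigma,\xi)=\inf_{\psi\in\mathcal{M}_{\sigma,\xi}}\langle\psi,H_0\psi\rangle .$$ Let $\Omega$ be the $N\times2^N$ matrix $\Omega_{n,\alpha}=(\sigma_z^n)_{\alpha\alpha}$. The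 vector $\sigma\in[-1,1]^N$ is called regular if for every $\omega\in\mathbb{R}^{2^N}$ with $\omega_\alpha\ge0$, $\sum_\alpha\omega_\alpha=1$ and $\Omega\omega=\sigma$, the affine hull of $\{\Omega e_\alpha:\omega_\alpha\neq0\}$ is $\mathbb{R}^N$. The tangent space of $\mathcal{M}_{\sigma,\xi}$ at $\psi$ is the real vector space $$\mathcal{T}_\psi(\mathcal{M}_{\sigma,\xi})=\{\chi\in Q_0:\operatorname{Re}\langle\psi,\chi\rangle=0,\ \operatorname{Re}\langle\sigma_z^n\psi,\chi\rangle=0\ (1\le n\le N),\ \operatorname{Re}\langle x_m\psi,\chi\rangle=0\ (1\le m\le M)\}.$$ **Theorem (Optimality).** Let $\sigma$ be regular, $\xi\in\mathbb{R}^M$, and let $\psi\in\mathcal{M}_{\sigma,\xi}$ be an optimizer, i.e. $\langle\psi,H_0\psi\rangle=F_{\mathrm{LL}}(\sigma,\xi)$. Then there exist $E\in\mathbb{R}$, $v\in\mathbb{R}^N$ and $j\in\mathbb{R}^M$ such that $\psi$ belongs to the domain of $H(v,j)$ and satisfies the strong Schrödinger equation $$H(v,j)\psi=E\psi,$$ the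 second-order condition $$\langle\chi,H(v,j)\chi\rangle\ge E\|\chi\|^2\qquad\text{for all }\chi\in\mathcal{T}_\psi(\mathcal{M}_{\sigma,\xi})$$ holds, and moreover $$F_{\mathrm{LL}}(\sigma,\xi)=\langle\psi,H_0\psi\rangle=E-v\cdot\sigma-j\cdot\xi .$$ -/

import Mathlib

open MeasureTheory Matrix
open scoped SchwartzMap Laplacian LineDeriv

noncomputable section

namespace Dicke

/-! ### Hilbert space -/

/-- Field configurations `x ∈ ℝ^M`. -/
abbrev Pos (M : ℕ) : Type := EuclideanSpace ℝ (Fin M)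

/-- Spin multi-indices `α ∈ {+,-}^N`; `0` stands for `+` and `1` for `-`. -/
abbrev Spin (N : ℕ) : Type := Fin N → Fin 2

/-- The spinor space `ℂ^{2^N}` with its Euclidean inner product. -/
abbrev Spinor (N : ℕ) : Type := EuclideanSpace ℂ (Spin N)

/-- The Hilbert space `L²(ℝ^M, ℂ^{2^N})`. -/
abbrev Hilb (M N : ℕ) : Type := Lp (Spinor N) 2 (volume : Measure (Pos M))

/-! ### Lifted Pauli matrices -/

def pauliX : Matrix (Fin 2) (Fin 2) ℂ := !![0, 1; 1, 0]

def pauliZ : Matrix (Fin 2) (Fin 2) ℂ := !![1, 0; 0, -1]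

/-- `1 ⊗ ⋯ ⊗ A ⊗ ⋯ ⊗ 1` with `A` in the `n`-th factor, written entrywise. -/
def lift {N : ℕ} (A : Matrix (Fin 2) (Fin 2) ℂ) (n : Fin N) : Matrix (Spin N) (Spin N) ℂ :=
  Matrix.of fun α β => ∏ i, (if i = n then A else 1) (α i) (β i)

/-- A spin matrix acting pointwise on `L²(ℝ^M, ℂ^{2^N})`. -/
def spinOp (M : ℕ) {N : ℕ} (A : Matrix (Spin N) (Spin N) ℂ) : Hilb M N →L[ℂ] Hilb M N :=
  (Matrix.toEuclideanCLM (n := Spin N) (𝕜 := ℂ) A).compLpL 2 volume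

/-- The operator `σ_z^n`. -/
def sigmaZ (M : ℕ) {N : ℕ} (n : Fin N) : Hilb M N →L[ℂ] Hilb M N := spinOp M (lift pauliZ n)

/-- The operator `σ_x^n`. -/
def sigmaX (M : ℕ) {N : ℕ} (n : Fin N) : Hilb M N →L[ℂ] Hilb M N := spinOp M (lift pauliX n)

/-! ### Unbounded operators: multiplications and weak derivatives -/

/-- Multiplication by the real function `w`, on its maximal domain `{ψ ∈ L² : w ψ ∈ L²}`. -/
def mulOp (M N : ℕ) (w : Pos M → ℝ) : Hilb M N →ₗ.[ℂ] Hilb M N where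
  domain :=
    { carrier := {ψ | MemLp (fun x => (w x : ℂ) • ψ x) 2 volume}
      zero_mem' := by
        refine (memLp_congr_ae ?_).2 (MemLp.zero (ε := Spinor N))
        filter_upwards [Lp.coeFn_zero (Spinor N) 2 (volume : Measure (Pos M))] with x hx
        simp only [hx, Pi.zero_apply, smul_zero]
      add_mem' := by
        intro ψ φ hψ hφ
        refine (memLp_congr_ae ?_).2 (hψ.add hφ)
        filter_upwards [Lp.coeFn_add ψ φ] with x hx
        simp only [hx, Pi.add_apply, smul_add]
      smul_mem' := by
        intro c ψ hψ
        refine (memLp_congr_ae ?_).2 (hψ.const_smul c)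
        filter_upwards [Lp.coeFn_smul c ψ] with x hx
        simp only [hx, Pi.smul_apply]
        exact smul_comm _ _ _ }
  toFun :=
    { toFun := fun ψ => MemLp.toLp _ ψ.2
      map_add' := by
        intro ψ φ
        refine Eq.trans ?_ (MemLp.toLp_add ψ.2 φ.2)
        refine MemLp.toLp_congr _ _ ?_
        filter_upwards [Lp.coeFn_add (ψ : Hilb M N) (φ : Hilb M N)] with x hx
        simp only [Submodule.coe_add, hx, Pi.add_apply, smul_add]
      map_smul' := by
        intro c ψ
        refine Eq.trans ?_ (MemLp.toLp_const_smul c ψ.2)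
        refine MemLp.toLp_congr _ _ ?_
        filter_upwards [Lp.coeFn_smul c (ψ : Hilb M N)] with x hx
        simp only [Submodule.coe_smul, hx, Pi.smul_apply]
        exact smul_comm _ _ _ }

/-- The embedding of `L²` into the tempered distributions, `ψ ↦ (φ ↦ ∫ φ ψ)`. -/
def toDist (M N : ℕ) : Hilb M N →L[ℂ] 𝓢'(Pos M, Spinor N) :=
  Lp.toTemperedDistributionCLM (Spinor N) volume 2

theorem toDist_injective (M N : ℕ) : Function.Injective (toDist M N) :=
  LinearMap.ker_eq_bot.1 (Lp.ker_toTemperedDistributionCLM_eq_bot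
    (E := Pos M) (F := Spinor N) (μ := volume) (p := 2))

/-- For an embedding `J : V → W` and an operator `T` on `W`, the part of `T` in `V`: the operator
`ψ ↦ T ψ` on the maximal domain `{ψ ∈ V : T ψ ∈ V}`. -/
def partOp {V W : Type*} [AddCommGroup V] [Module ℂ V] [AddCommGroup W] [Module ℂ W]
    (J : V →ₗ[ℂ] W) (hJ : Function.Injective J) (T : W →ₗ[ℂ] W) : V →ₗ.[ℂ] V where
  domain :=
    { carrier := {ψ | ∃ g : V, T (J ψ) = J g}
      zero_mem' := ⟨0, by simp⟩
      add_mem' := by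
        rintro ψ φ ⟨g, hg⟩ ⟨h, hh⟩
        exact ⟨g + h, by simp only [map_add, hg, hh]⟩
      smul_mem' := by
        rintro c ψ ⟨g, hg⟩
        exact ⟨c • g, by simp only [map_smul, hg]⟩ }
  toFun :=
    { toFun := fun ψ => ψ.2.choose
      map_add' := by
        intro ψ φ
        apply hJ
        rw [map_add, ← (ψ + φ).2.choose_spec, ← ψ.2.choose_spec, ← φ.2.choose_spec]
        simp only [Submodule.coe_add, map_add]
      map_smul' := by
        intro c ψ
        apply hJ
        rw [RingHom.id_apply, map_smul, ← (c • ψ).2.choose_spec, ← ψ.2.choose_spec]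
        simp only [Submodule.coe_smul, map_smul] }

/-- `partOp J hJ T ψ` is the element of `V` that represents `T ψ`. -/
theorem partOp_spec {V W : Type*} [AddCommGroup V] [Module ℂ V] [AddCommGroup W] [Module ℂ W]
    (J : V →ₗ[ℂ] W) (hJ : Function.Injective J) (T : W →ₗ[ℂ] W) (ψ : (partOp J hJ T).domain) :
    J (partOp J hJ T ψ) = T (J (ψ : V)) :=
  ψ.2.choose_spec.symm

/-- The `L²`-realization of an operator `T` on tempered distributions, on its maximal domain
`{ψ ∈ L² : T ψ ∈ L²}`. -/
def distOp {M N : ℕ} (T : 𝓢'(Pos M, Spinor N) →L[ℂ] 𝓢'(Pos M, Spinor N)) :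
    Hilb M N →ₗ.[ℂ] Hilb M N :=
  partOp (toDist M N).toLinearMap (toDist_injective M N) T.toLinearMap

/-- Multiplication by the coordinate `x_m`. -/
def coord (N : ℕ) {M : ℕ} (m : Fin M) : Hilb M N →ₗ.[ℂ] Hilb M N := mulOp M N fun x => x m

/-- The weak partial derivative `∂/∂x_m`. -/
def partialDeriv (N : ℕ) {M : ℕ} (m : Fin M) : Hilb M N →ₗ.[ℂ] Hilb M N :=
  distOp (LineDeriv.lineDerivOpCLM ℂ 𝓢'(Pos M, Spinor N) (EuclideanSpace.single m (1 : ℝ)))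

/-- The weak Laplacian. -/
def laplace (M N : ℕ) : Hilb M N →ₗ.[ℂ] Hilb M N :=
  distOp (LineDeriv.laplacianCLM ℂ (Pos M) 𝓢'(Pos M, Spinor N))

/-! ### The Hamiltonians

Sums of unbounded operators have the intersection of the domains as their domain, so both
operators below live on `{ψ ∈ L² : Δψ ∈ L², |x|²ψ ∈ L²}` (where `x_m ψ ∈ L²` is automatic), which
is the domain of the closure of the operator on `C_c^∞(ℝ^M, ℂ^{2^N})`. -/

/-- `H₀ = -Δ + |x|² + x · Λ σ_z - t · σ_x`. -/
def H₀ {M N : ℕ} (Λ : Matrix (Fin M) (Fin N) ℝ) (t : Fin N → ℝ) : Hilb M N →ₗ.[ℂ] Hilb M N :=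
  -laplace M N + mulOp M N (fun x => ‖x‖ ^ 2)
    + ∑ m, ∑ n, ((Λ m n : ℝ) : ℂ) • (sigmaZ M n).toLinearMap.compPMap (coord N m)
    - ∑ n, ((t n : ℝ) : ℂ) • (sigmaX M n).toLinearMap.toPMap ⊤

/-- `H(v, j) = H₀ + v · σ_z + j · x`. -/
def H {M N : ℕ} (Λ : Matrix (Fin M) (Fin N) ℝ) (t : Fin N → ℝ) (v : Fin N → ℝ) (j : Fin M → ℝ) :
    Hilb M N →ₗ.[ℂ] Hilb M N :=
  H₀ Λ t + ∑ n, ((v n : ℝ) : ℂ) • (sigmaZ M n).toLinearMap.toPMap ⊤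
    + ∑ m, ((j m : ℝ) : ℂ) • coord N m

/-! ### Form domain and quadratic forms -/

/-- The form domain `Q₀ = {ψ ∈ L² : ∂_m ψ ∈ L² and x_m ψ ∈ L² for all m}` of `H₀`. -/
def Q₀ (M N : ℕ) : Submodule ℂ (Hilb M N) :=
  ⨅ m : Fin M, (partialDeriv N m).domain ⊓ (coord N m).domain

/-- `∂_m ψ` for `ψ ∈ Q₀`. -/
def dQ {M N : ℕ} (m : Fin M) (ψ : Q₀ M N) : Hilb M N :=
  partialDeriv N m ⟨ψ, ((Submodule.mem_iInf _).1 ψ.2 m).1⟩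

/-- `x_m ψ` for `ψ ∈ Q₀`. -/
def xQ {M N : ℕ} (m : Fin M) (ψ : Q₀ M N) : Hilb M N :=
  coord N m ⟨ψ, ((Submodule.mem_iInf _).1 ψ.2 m).2⟩

/-- The magnetization `σ_ψ = ⟨ψ, σ_z ψ⟩` (these inner products are real). -/
def magnetization {M N : ℕ} (ψ : Hilb M N) : Fin N → ℝ :=
  fun n => (inner ℂ ψ (sigmaZ M n ψ)).re

/-- The displacement `ξ_ψ = ⟨ψ, x ψ⟩` (these inner products are real). -/
def displacement {M N : ℕ} (ψ : Q₀ M N) : Fin M → ℝ :=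
  fun m => (inner ℂ (ψ : Hilb M N) (xQ m ψ)).re

/-- The quadratic form `⟨ψ, H₀ ψ⟩ = ‖∇ψ‖² + ‖xψ‖² + ⟨ψ, x · Λ σ_z ψ⟩ - ⟨ψ, t · σ_x ψ⟩` on `Q₀`. -/
def form₀ {M N : ℕ} (Λ : Matrix (Fin M) (Fin N) ℝ) (t : Fin N → ℝ) (ψ : Q₀ M N) : ℝ :=
  ∑ m, ‖dQ m ψ‖ ^ 2 + ∑ m, ‖xQ m ψ‖ ^ 2
    + ∑ m, ∑ n, Λ m n * (inner ℂ (ψ : Hilb M N) (sigmaZ M n (xQ m ψ))).re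
    - ∑ n, t n * (inner ℂ (ψ : Hilb M N) (sigmaX M n (ψ : Hilb M N))).re

/-- The quadratic form `⟨ψ, H(v, j) ψ⟩` on `Q₀`. -/
def form {M N : ℕ} (Λ : Matrix (Fin M) (Fin N) ℝ) (t : Fin N → ℝ) (v : Fin N → ℝ) (j : Fin M → ℝ)
    (ψ : Q₀ M N) : ℝ :=
  form₀ Λ t ψ + v ⬝ᵥ magnetization (ψ : Hilb M N) + j ⬝ᵥ displacement ψ

/-! ### Regular magnetizations, the constraint manifold and the Levy--Lieb functional -/

/-- The `N × 2^N` matrix whose `n`-th row is the diagonal of `σ_z^n`. -/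
def Omega (N : ℕ) : Matrix (Fin N) (Spin N) ℝ :=
  Matrix.of fun n α => (lift pauliZ n α α).re

/-- Regularity of a magnetization `σ ∈ [-1,1]^N`. -/
def IsRegular {N : ℕ} (σ : Fin N → ℝ) : Prop :=
  (∀ n, σ n ∈ Set.Icc (-1 : ℝ) 1) ∧
    ∀ ω : Spin N → ℝ, (∀ α, 0 ≤ ω α) → ∑ α, ω α = 1 → Omega N *ᵥ ω = σ →
      affineSpan ℝ ((fun α => Omega N *ᵥ Pi.single α (1 : ℝ)) '' {α | ω α ≠ 0}) = ⊤

/-- The constraint manifold `M_{σ,ξ}`. -/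
def constraintSet {M N : ℕ} (σ : Fin N → ℝ) (ξ : Fin M → ℝ) : Set (Q₀ M N) :=
  {ψ | ‖(ψ : Hilb M N)‖ = 1 ∧ magnetization (ψ : Hilb M N) = σ ∧ displacement ψ = ξ}

/-- The Levy--Lieb functional `F_LL(σ, ξ) = inf {⟨ψ, H₀ ψ⟩ : ψ ∈ M_{σ,ξ}}`. -/
def FLL {M N : ℕ} (Λ : Matrix (Fin M) (Fin N) ℝ) (t : Fin N → ℝ) (σ : Fin N → ℝ)
    (ξ : Fin M → ℝ) : ℝ :=
  sInf (form₀ Λ t '' constraintSet σ ξ)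

/-- The tangent space of the constraint manifold at `ψ`, a real vector space: the kernel of the
differential `χ ↦ 2 Re (⟨ψ, χ⟩, ⟨σ_z ψ, χ⟩, ⟨x ψ, χ⟩)` of the constraint map
`ψ ↦ (‖ψ‖², σ_ψ, ξ_ψ)` on `Q₀`. In particular it contains every `χ ∈ Q₀` for which the complex
inner products `⟨ψ, χ⟩`, `⟨σ_z^n ψ, χ⟩` and `⟨x_m ψ, χ⟩` vanish. -/
def tangentSpace {M N : ℕ} (ψ : Q₀ M N) : Set (Q₀ M N) :=
  {χ | (inner ℂ (ψ : Hilb M N) (χ : Hilb M N)).re = 0 ∧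
    (∀ n, (inner ℂ (sigmaZ M n (ψ : Hilb M N)) (χ : Hilb M N)).re = 0) ∧
    ∀ m, (inner ℂ (xQ m ψ) (χ : Hilb M N)).re = 0}

end Dicke

end

/-! The optimizer minimizes a real quadratic form on `Q₀` under the `1 + N + M` quadratic
constraints `‖ψ‖²`, `σ_ψ`, `ξ_ψ`, so `E`, `-v`, `-j` are Lagrange multipliers. The constraint
differentials at `ψ` are the functionals `2 Re ⟨h, ·⟩` with `h` equal to `ψ`, `σ_z^n ψ` or `x_m ψ`.
A real linear relation among these vectors says `(c + a · Ω e_α + b · x) ψ_α(x) = 0` almost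
everywhere. If `b ≠ 0`, the bracket vanishes only on a null set and `ψ = 0`. If `b = 0`, the affine
function `c + a · y` vanishes at every `Ω e_α` of nonzero weight, and regularity forces `c = 0` and
`a = 0` (`constraint_independent`).

Independence makes the differential surjective, so the inverse function theorem in finitely many
parameters gives a curve in the constraint set through each tangent direction. Comparing energies
along it to first and second order gives the multiplier identity and the second-order condition
(`exists_multipliers`).

The multiplier identity is the Schrödinger equation in weak form, that is `(-Δ + |x|²) ψ = f` tested
on `Q₀`. Here `f` is in `L²` because it involves only `ψ`, spin operators and `x_m ψ`. Testing with
a bounded truncation of `|x|² ψ` bounds `|x|² ψ` in `L²`; the equation then puts `Δψ` in `L²`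
(`strong_of_weak`), so `ψ` lies in the operator domain. Testing the weak equation with `ψ` itself
gives the energy identity. -/

noncomputable section

namespace Dicke

/-! ### Lagrange multipliers for quadratic problems with quadratic constraints -/

section Multipliers

open Filter Topology Asymptotics

variable {V ι : Type*} [AddCommGroup V] [Module ℝ V] [Fintype ι]

/-- Linearly independent functionals admit a dual family of vectors. -/
theorem exists_dual_family [DecidableEq ι] {l : ι → V →ₗ[ℝ] ℝ}
    (hl : ∀ c : ι → ℝ, (∀ χ, ∑ i, c i * l i χ = 0) → c = 0) :
    ∃ η : ι → V, ∀ i k, l i (η k) = if i = k then 1 else 0 := by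
  have hsurj : LinearMap.range (LinearMap.pi l) = ⊤ := by
    by_contra hne
    -- A proper range is annihilated by a nonzero functional on `ι → ℝ`, whose coordinates form a
    -- nontrivial relation among the `l i`.
    obtain ⟨f, hf, hker⟩ := Submodule.exists_le_ker_of_lt_top _ (lt_top_iff_ne_top.2 hne)
    have hfc : ∀ y : ι → ℝ, f y = ∑ i, f (Pi.single i 1) * y i := by
      intro y
      conv_lhs => rw [← Finset.univ_sum_single y]
      rw [map_sum]
      refine Finset.sum_congr rfl fun i _ => ?_
      have : (Pi.single i (y i) : ι → ℝ) = y i • Pi.single i 1 := by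
        rw [← Pi.single_smul]; simp
      rw [this, map_smul, smul_eq_mul, mul_comm]
    apply hf
    have h0 := hl (fun i => f (Pi.single i 1)) fun χ => by
      have := hker (LinearMap.mem_range_self (LinearMap.pi l) χ)
      rw [LinearMap.mem_ker, hfc] at this
      simpa using this
    ext y
    simpa using congrFun h0 y
  have hs := LinearMap.range_eq_top.1 hsurj
  choose η hη using fun k => hs (Pi.single k (1 : ℝ))
  refine ⟨η, fun i k => ?_⟩
  have := congrFun (hη k) i
  simpa [Pi.single_apply] using this

/-- A bilinear form, restricted to the diagonal of a finite-dimensional space, has vanishing strict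
derivative at the origin. -/
theorem hasStrictFDerivAt_bilin_diag_zero {E : Type*} [NormedAddCommGroup E] [NormedSpace ℝ E]
    [FiniteDimensional ℝ E] (b : E →ₗ[ℝ] E →ₗ[ℝ] ℝ) :
    HasStrictFDerivAt (fun z => b z z) (0 : E →L[ℝ] ℝ) 0 := by
  have h := HasStrictFDerivAt.comp (f := fun z : E => (z, z)) (0 : E)
    (b.toContinuousBilinearMap.isBoundedBilinearMap.hasStrictFDerivAt ((0 : E), (0 : E)))
    ((hasStrictFDerivAt_id (𝕜 := ℝ) (0 : E)).prodMk (hasStrictFDerivAt_id (0 : E)))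
  refine HasStrictFDerivAt.congr_fderiv h ?_
  ext z
  simp [IsBoundedBilinearMap.deriv_apply]

/-- Directions in the kernel of the differential of a quadratic constraint map are tangent to curves
in its level set. -/
theorem exists_curve_of_tangent [DecidableEq ι] (G : ι → LinearMap.BilinForm ℝ V)
    (hG : ∀ i x y, G i x y = G i y x) (ψ χ : V) (η : ι → V)
    (hη : ∀ i k, G i ψ (η k) = if i = k then 1 else 0) (hχ : ∀ i, G i ψ χ = 0) :
    ∃ y : ℝ → ι → ℝ, y =o[𝓝 0] (fun s => s) ∧ ∀ᶠ s in 𝓝 (0 : ℝ), ∀ i,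
      G i (ψ + (s • χ + ∑ k, y s k • η k)) (ψ + (s • χ + ∑ k, y s k • η k)) = G i ψ ψ := by
  -- Only the span of `χ` and the `η k` is used, so the calculus is finite-dimensional and `V` needs
  -- no topology.
  let S : ℝ × (ι → ℝ) →ₗ[ℝ] V :=
    LinearMap.coprod (LinearMap.toSpanSingleton ℝ V χ) (Fintype.linearCombination ℝ η)
  have hS : ∀ z : ℝ × (ι → ℝ), S z = z.1 • χ + ∑ k, z.2 k • η k := fun z => by
    simp [S, Fintype.linearCombination_apply]
  have hexp : ∀ i z, G i (ψ + S z) (ψ + S z) = G i ψ ψ + 2 * z.2 i + G i (S z) (S z) := by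
    intro i z
    have h1 : G i ψ (S z) = z.2 i := by
      rw [hS, map_add, map_smul, hχ, smul_zero, zero_add, map_sum,
        Finset.sum_eq_single i]
      · simp [hη]
      · intro k _ hk; simp [hη, Ne.symm hk]
      · simp
    simp only [map_add, LinearMap.add_apply, hG i (S z) ψ, h1]
    ring
  -- By `hexp`, the second component is half the change of the constraints at `ψ + S z`. Duality of
  -- `η` and tangency of `χ` make the derivative at `0` the identity, and the curve is the preimage
  -- of `s ↦ (s, 0)`.
  let F : ℝ × (ι → ℝ) → ℝ × (ι → ℝ) :=
    fun z => (z.1, fun i => z.2 i + 2⁻¹ * G i (S z) (S z))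
  have hF : HasStrictFDerivAt F
      ((ContinuousLinearEquiv.refl ℝ (ℝ × (ι → ℝ)) : (ℝ × (ι → ℝ)) →L[ℝ] ℝ × (ι → ℝ))) 0 := by
    have hq : ∀ i, HasStrictFDerivAt (fun z : ℝ × (ι → ℝ) => z.2 i + 2⁻¹ * G i (S z) (S z))
        ((ContinuousLinearMap.proj i).comp (ContinuousLinearMap.snd ℝ ℝ (ι → ℝ))) 0 := by
      intro i
      have h1 := (hasStrictFDerivAt_bilin_diag_zero
        ((G i).compl₁₂ S S)).const_mul (2⁻¹ : ℝ)
      have h2 := ((ContinuousLinearMap.proj (R := ℝ) (φ := fun _ : ι => ℝ) i).comp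
        (ContinuousLinearMap.snd ℝ ℝ (ι → ℝ))).hasStrictFDerivAt (x := 0)
      refine (h2.add h1).congr_fderiv ?_
      simp
    refine ((hasStrictFDerivAt_fst (𝕜 := ℝ) (p := (0 : ℝ × (ι → ℝ)))).prodMk
      (hasStrictFDerivAt_pi.2 hq)).congr_fderiv ?_
    ext z <;> simp
  have hF0 : F 0 = 0 := by ext <;> simp [F]
  let g := hF.localInverse
  have hg := hF.to_localInverse
  have hg0 : g 0 = 0 := by
    have := hF.localInverse_apply_image
    rwa [hF0] at this
  have hr := hF.eventually_right_inverse
  rw [hF0] at hg hr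
  have hpath : Tendsto (fun s : ℝ => ((s, 0) : ℝ × (ι → ℝ))) (𝓝 0) (𝓝 0) := by
    have : Continuous fun s : ℝ => ((s, 0) : ℝ × (ι → ℝ)) := by fun_prop
    exact this.tendsto 0
  refine ⟨fun s => (g (s, 0)).2, ?_, ?_⟩
  -- The local inverse also has identity derivative, so `g (s, 0) - (s, 0) = o(s)`; the correction
  -- `y s` is its second component.
  · have h1 := hg.hasFDerivAt.isLittleO.comp_tendsto hpath
    have h2 : (fun s : ℝ => (g (s, 0)).2) =O[𝓝 0]
        fun s : ℝ => g (s, 0) - g 0 - (((s, 0) : ℝ × (ι → ℝ)) - 0) := by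
      refine IsBigO.of_bound 1 (Eventually.of_forall fun s => ?_)
      rw [hg0, one_mul]
      calc ‖(g (s, 0)).2‖ = ‖(g (s, 0) - 0 - (((s, 0) : ℝ × (ι → ℝ)) - 0)).2‖ := by simp
        _ ≤ _ := norm_snd_le _
    refine h2.trans_isLittleO (h1.trans_isBigO (IsBigO.of_bound 1 (Eventually.of_forall fun s => ?_)))
    simp [Prod.norm_def]
  · filter_upwards [hpath.eventually hr] with s hs i
    have hs1 : (g (s, 0)).1 = s := congrArg Prod.fst hs
    have hs2 : (g (s, 0)).2 i + 2⁻¹ * G i (S (g (s, 0))) (S (g (s, 0))) = 0 :=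
      congrFun (congrArg Prod.snd hs) i
    have := hexp i (g (s, 0))
    rw [hS, hs1] at this
    rw [this]
    rw [hS, hs1] at hs2
    linarith

/-- First- and second-order optimality conditions for the minimization of a quadratic form under
quadratic constraints whose differentials at the minimizer are linearly independent. -/
theorem exists_multipliers (B : LinearMap.BilinForm ℝ V) (hB : ∀ x y, B x y = B y x)
    (G : ι → LinearMap.BilinForm ℝ V) (hG : ∀ i x y, G i x y = G i y x) (ψ : V)
    (hind : ∀ c : ι → ℝ, (∀ χ, ∑ i, c i * G i ψ χ = 0) → c = 0)
    (hmin : ∀ φ, (∀ i, G i φ φ = G i ψ ψ) → B ψ ψ ≤ B φ φ) :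
    ∃ l : ι → ℝ, (∀ χ, B ψ χ = ∑ i, l i * G i ψ χ) ∧
      ∀ χ, (∀ i, G i ψ χ = 0) → ∑ i, l i * G i χ χ ≤ B χ χ := by
  classical
  obtain ⟨η, hη⟩ := exists_dual_family hind
  -- a minimum along a tangent curve, rescaled
  have key : ∀ (A : LinearMap.BilinForm ℝ V) (χ : V) (y : ℝ → ι → ℝ),
      y =o[𝓝 0] (fun s : ℝ => s) → ∀ φ : V,
      Tendsto (fun s => A φ (χ + ∑ k, (s⁻¹ * y s k) • η k)) (𝓝[≠] 0) (𝓝 (A φ χ)) ∧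
      Tendsto (fun s => A (χ + ∑ k, (s⁻¹ * y s k) • η k) (χ + ∑ k, (s⁻¹ * y s k) • η k))
        (𝓝[≠] 0) (𝓝 (A χ χ)) := by
    intro A χ y hy φ
    have hk : ∀ k, Tendsto (fun s => s⁻¹ * y s k) (𝓝[≠] 0) (𝓝 0) := by
      intro k
      have h1 : (fun s => y s k) =o[𝓝 0] (fun s : ℝ => s) :=
        (isLittleO_pi.1 hy k)
      refine (h1.tendsto_div_nhds_zero.mono_left nhdsWithin_le_nhds).congr fun s => ?_
      rw [div_eq_inv_mul]
    constructor
    · simp only [map_add, map_sum, map_smul, smul_eq_mul]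
      have : Tendsto (fun s => A φ χ + ∑ k, (s⁻¹ * y s k) * A φ (η k)) (𝓝[≠] 0)
          (𝓝 (A φ χ + ∑ k, 0 * A φ (η k))) :=
        tendsto_const_nhds.add (tendsto_finsetSum _ fun k _ => (hk k).mul_const _)
      simpa using this
    · simp only [map_add, map_sum, map_smul, smul_eq_mul, LinearMap.add_apply, LinearMap.sum_apply,
        LinearMap.smul_apply]
      have : Tendsto (fun s => A χ χ + ∑ k, (s⁻¹ * y s k) * A (η k) χ +
          ∑ k, (s⁻¹ * y s k) * (A χ (η k) + ∑ i, (s⁻¹ * y s i) * A (η i) (η k))) (𝓝[≠] 0)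
          (𝓝 (A χ χ + ∑ k, 0 * A (η k) χ +
            ∑ k, 0 * (A χ (η k) + ∑ i, 0 * A (η i) (η k)))) :=
        (tendsto_const_nhds.add (tendsto_finsetSum _ fun k _ => (hk k).mul_const _)).add
          (tendsto_finsetSum _ fun k _ => (hk k).mul (tendsto_const_nhds.add
            (tendsto_finsetSum _ fun i _ => (hk i).mul_const _)))
      simpa using this
  have hscale : ∀ (χ : V) (y : ℝ → ι → ℝ) (s : ℝ), s ≠ 0 →
      s • χ + ∑ k, y s k • η k = s • (χ + ∑ k, (s⁻¹ * y s k) • η k) := by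
    intro χ y s hs
    rw [smul_add, Finset.smul_sum]
    congr 1
    refine Finset.sum_congr rfl fun k _ => ?_
    rw [smul_smul, mul_inv_cancel_left₀ hs]
  -- For `s > 0`, divide the energy increment along the curve by `s` and let `s → 0`. Applying this
  -- to `-χ` later gives equality.
  have hfirst_le : ∀ χ, (∀ i, G i ψ χ = 0) → 0 ≤ B ψ χ := by
    intro χ hχ
    obtain ⟨y, hy, hyG⟩ := exists_curve_of_tangent G hG ψ χ η hη hχ
    obtain ⟨h1, h2⟩ := key B χ y hy ψ
    have hle : (𝓝[>] (0 : ℝ)) ≤ 𝓝[≠] 0 := nhdsWithin_mono _ fun s hs => ne_of_gt hs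
    have hs0 : Tendsto (fun s : ℝ => s) (𝓝[>] 0) (𝓝 0) := tendsto_id.mono_left nhdsWithin_le_nhds
    have hlim := ((h1.mono_left hle).const_mul 2).add (hs0.mul (h2.mono_left hle))
    have : 0 ≤ 2 * B ψ χ + 0 * B χ χ := by
      refine ge_of_tendsto hlim ?_
      filter_upwards [self_mem_nhdsWithin, nhdsWithin_le_nhds hyG] with s hs hsG
      have hmin' := hmin _ hsG
      have hs : 0 < s := hs
      rw [hscale χ y s hs.ne'] at hmin'
      set h := χ + ∑ k, (s⁻¹ * y s k) • η k
      simp only [map_add, LinearMap.add_apply, map_smul, LinearMap.smul_apply, smul_eq_mul,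
        hB h ψ] at hmin'
      have : 0 ≤ s * (2 * B ψ h + s * B h h) := by nlinarith
      exact nonneg_of_mul_nonneg_right this hs
    linarith
  have hfirst : ∀ χ, (∀ i, G i ψ χ = 0) → B ψ χ = 0 := by
    intro χ hχ
    refine le_antisymm ?_ (hfirst_le χ hχ)
    have := hfirst_le (-χ) fun i => by rw [map_neg, hχ, neg_zero]
    rw [map_neg] at this
    linarith
  have hmul : ∀ χ, B ψ χ = ∑ i, B ψ (η i) * G i ψ χ := by
    intro χ
    -- Subtracting the dual vectors makes an arbitrary `χ` tangent, which identifies the multipliers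
    -- as `B ψ (η i)`.
    have := hfirst (χ - ∑ k, G k ψ χ • η k) fun i => by
      simp [map_sub, map_sum, hη]
    rw [map_sub, map_sum, sub_eq_zero] at this
    rw [this]
    refine Finset.sum_congr rfl fun k _ => ?_
    rw [map_smul, smul_eq_mul, mul_comm]
  refine ⟨fun i => B ψ (η i), hmul, fun χ hχ => ?_⟩
  obtain ⟨y, hy, hyG⟩ := exists_curve_of_tangent G hG ψ χ η hη hχ
  have hlim := ((key B χ y hy ψ).2.sub
    (tendsto_finsetSum Finset.univ fun i _ => ((key (G i) χ y hy ψ).2.const_mul (B ψ (η i)))))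
  rw [← sub_nonneg]
  refine ge_of_tendsto hlim ?_
  filter_upwards [self_mem_nhdsWithin, nhdsWithin_le_nhds hyG] with s hs hsG
  have hmin' := hmin _ hsG
  have hs : s ≠ 0 := hs
  rw [hscale χ y s hs] at hmin' hsG
  set h := χ + ∑ k, (s⁻¹ * y s k) • η k
  -- Exact constraint preservation trades the first-order terms for second-order ones. Through
  -- `hmul` the increment of `B` becomes `s²` times `B h h - ∑ i, l i * G i h h`, where `h → χ`.
  have hGh : ∀ i, 2 * G i ψ h = - (s * G i h h) := by
    intro i
    have := hsG i
    simp only [map_add, LinearMap.add_apply, map_smul, LinearMap.smul_apply, smul_eq_mul,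
      hG i h ψ] at this
    have : s * (2 * G i ψ h + s * G i h h) = 0 := by linarith
    have := (mul_eq_zero.1 this).resolve_left hs
    linarith
  have hBh : 2 * B ψ h = - (s * ∑ i, B ψ (η i) * G i h h) := by
    rw [hmul h, Finset.mul_sum, Finset.mul_sum, ← Finset.sum_neg_distrib]
    refine Finset.sum_congr rfl fun i _ => ?_
    linear_combination B ψ (η i) * hGh i
  simp only [map_add, LinearMap.add_apply, map_smul, LinearMap.smul_apply, smul_eq_mul,
    hB h ψ] at hmin'
  have : 0 ≤ s ^ 2 * (B h h - ∑ i, B ψ (η i) * G i h h) := by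
    linear_combination hmin' + s * hBh
  exact nonneg_of_mul_nonneg_right this (by positivity)

end Multipliers

/-! ### Elements of the form domain -/

section FormDomain

variable {M N : ℕ}

theorem toDist_apply (ψ : Hilb M N) (φ : 𝓢(Pos M, ℂ)) :
    toDist M N ψ φ = ∫ x, φ x • ψ x :=
  Lp.toTemperedDistribution_apply ψ φ

theorem mem_Q₀_iff {ψ : Hilb M N} :
    ψ ∈ Q₀ M N ↔ ∀ m : Fin M,
      (∃ g : Hilb M N, ∂_{EuclideanSpace.single m (1 : ℝ)} (toDist M N ψ) = toDist M N g) ∧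
        MemLp (fun x => ((x m : ℝ) : ℂ) • ψ x) 2 volume := by
  rw [Q₀, Submodule.mem_iInf]
  exact Iff.rfl

theorem toDist_dQ (m : Fin M) (ψ : Q₀ M N) :
    toDist M N (dQ m ψ) = ∂_{EuclideanSpace.single m (1 : ℝ)} (toDist M N ψ) :=
  partOp_spec (toDist M N).toLinearMap (toDist_injective M N) _
    ⟨ψ, ((Submodule.mem_iInf _).1 ψ.2 m).1⟩

theorem dQ_eq_of_toDist {m : Fin M} {ψ : Q₀ M N} {g : Hilb M N}
    (h : ∂_{EuclideanSpace.single m (1 : ℝ)} (toDist M N (ψ : Hilb M N)) = toDist M N g) :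
    dQ m ψ = g :=
  toDist_injective M N ((toDist_dQ m ψ).trans h)

theorem coeFn_xQ (m : Fin M) (ψ : Q₀ M N) :
    xQ m ψ =ᵐ[volume] fun x => ((x m : ℝ) : ℂ) • (ψ : Hilb M N) x :=
  MemLp.coeFn_toLp ((Submodule.mem_iInf _).1 ψ.2 m).2

theorem dQ_add (m : Fin M) (ψ φ : Q₀ M N) : dQ m (ψ + φ) = dQ m ψ + dQ m φ :=
  (partialDeriv N m).map_add ⟨ψ, ((Submodule.mem_iInf _).1 ψ.2 m).1⟩
    ⟨φ, ((Submodule.mem_iInf _).1 φ.2 m).1⟩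

theorem dQ_smul (m : Fin M) (c : ℂ) (ψ : Q₀ M N) : dQ m (c • ψ) = c • dQ m ψ :=
  (partialDeriv N m).map_smul c ⟨ψ, ((Submodule.mem_iInf _).1 ψ.2 m).1⟩

theorem xQ_add (m : Fin M) (ψ φ : Q₀ M N) : xQ m (ψ + φ) = xQ m ψ + xQ m φ :=
  (coord N m).map_add ⟨ψ, ((Submodule.mem_iInf _).1 ψ.2 m).2⟩
    ⟨φ, ((Submodule.mem_iInf _).1 φ.2 m).2⟩

theorem xQ_smul (m : Fin M) (c : ℂ) (ψ : Q₀ M N) : xQ m (c • ψ) = c • xQ m ψ :=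
  (coord N m).map_smul c ⟨ψ, ((Submodule.mem_iInf _).1 ψ.2 m).2⟩

/-! ### Spin operators -/

theorem coeFn_spinOp (A : Matrix (Spin N) (Spin N) ℂ) (ψ : Hilb M N) :
    spinOp M A ψ =ᵐ[volume] fun x => Matrix.toEuclideanCLM (n := Spin N) (𝕜 := ℂ) A (ψ x) :=
  ContinuousLinearMap.coeFn_compLpL _ _

theorem inner_toEuclideanCLM {A : Matrix (Spin N) (Spin N) ℂ} (hA : A.IsHermitian)
    (a b : Spinor N) :
    inner ℂ (Matrix.toEuclideanCLM (n := Spin N) (𝕜 := ℂ) A a) b =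
      inner ℂ a (Matrix.toEuclideanCLM (n := Spin N) (𝕜 := ℂ) A b) := by
  have h : ContinuousLinearMap.adjoint (Matrix.toEuclideanCLM (n := Spin N) (𝕜 := ℂ) A) =
      Matrix.toEuclideanCLM (n := Spin N) (𝕜 := ℂ) A := by
    rw [← ContinuousLinearMap.star_eq_adjoint, ← map_star, Matrix.star_eq_conjTranspose, hA.eq]
  conv_lhs => rw [← h]
  exact ContinuousLinearMap.adjoint_inner_left _ _ _

theorem inner_spinOp {A : Matrix (Spin N) (Spin N) ℂ} (hA : A.IsHermitian) (ψ φ : Hilb M N) :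
    inner ℂ (spinOp M A ψ) φ = inner ℂ ψ (spinOp M A φ) := by
  rw [L2.inner_def, L2.inner_def]
  refine integral_congr_ae ?_
  filter_upwards [coeFn_spinOp A ψ, coeFn_spinOp A φ] with x h1 h2
  rw [h1, h2, inner_toEuclideanCLM hA]

theorem inner_spinOp_xQ {A : Matrix (Spin N) (Spin N) ℂ} (hA : A.IsHermitian) (m : Fin M)
    (ψ φ : Q₀ M N) :
    inner ℂ (spinOp M A (xQ m ψ)) (φ : Hilb M N) =
      inner ℂ (ψ : Hilb M N) (spinOp M A (xQ m φ)) := by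
  rw [L2.inner_def, L2.inner_def]
  refine integral_congr_ae ?_
  filter_upwards [coeFn_spinOp A (xQ m ψ), coeFn_spinOp A (xQ m φ), coeFn_xQ m ψ, coeFn_xQ m φ]
    with x h1 h2 h3 h4
  rw [h1, h2, h3, h4, inner_toEuclideanCLM hA, map_smul, inner_smul_left,
    inner_smul_right, Complex.conj_ofReal]

theorem inner_xQ (m : Fin M) (ψ φ : Q₀ M N) :
    inner ℂ (xQ m ψ) (φ : Hilb M N) = inner ℂ (ψ : Hilb M N) (xQ m φ) := by
  rw [L2.inner_def, L2.inner_def]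
  refine integral_congr_ae ?_
  filter_upwards [coeFn_xQ m ψ, coeFn_xQ m φ] with x h3 h4
  rw [h3, h4, inner_smul_left, inner_smul_right, Complex.conj_ofReal]

theorem isHermitian_lift {A : Matrix (Fin 2) (Fin 2) ℂ} (hA : A.IsHermitian) (n : Fin N) :
    (lift A n).IsHermitian := by
  ext α β
  simp only [lift, Matrix.conjTranspose_apply, Matrix.of_apply, star_prod]
  refine Finset.prod_congr rfl fun i _ => ?_
  by_cases h : i = n
  · simp only [h, if_true]; exact hA.apply _ _
  · simp only [h, if_false]; exact Matrix.isHermitian_one.apply _ _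

theorem isHermitian_pauliX : pauliX.IsHermitian := by
  ext i k
  fin_cases i <;> fin_cases k <;> simp [pauliX]

theorem isHermitian_pauliZ : pauliZ.IsHermitian := by
  ext i k
  fin_cases i <;> fin_cases k <;> simp [pauliZ]

/-! ### Schwartz functions in the form domain -/

theorem toDist_toLp (f : 𝓢(Pos M, Spinor N)) :
    toDist M N (f.toLp 2 volume) = SchwartzMap.toTemperedDistributionCLM (Pos M) (Spinor N) volume f :=
  Lp.toTemperedDistribution_toLp_eq f

theorem lineDeriv_toDist_toLp (f : 𝓢(Pos M, Spinor N)) (v : Pos M) :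
    ∂_{v} (toDist M N (f.toLp 2 volume)) = toDist M N ((∂_{v} f).toLp 2) := by
  rw [toDist_toLp, toDist_toLp, TemperedDistribution.lineDerivOp_toTemperedDistributionCLM_eq]

theorem hasTemperateGrowth_coord (m : Fin M) :
    (fun x : Pos M => x m).HasTemperateGrowth :=
  (EuclideanSpace.proj (𝕜 := ℝ) m).hasTemperateGrowth

theorem toLp_mem_Q₀ (f : 𝓢(Pos M, Spinor N)) : f.toLp 2 volume ∈ Q₀ M N := by
  refine mem_Q₀_iff.2 fun m => ⟨⟨_, lineDeriv_toDist_toLp f _⟩, ?_⟩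
  have h := (SchwartzMap.smulLeftCLM (Spinor N) (fun x : Pos M => x m) f).memLp 2 volume
  refine (memLp_congr_ae ?_).1 h
  filter_upwards [f.coeFn_toLp 2 volume] with x hx
  rw [hx, SchwartzMap.smulLeftCLM_apply_apply (hasTemperateGrowth_coord m)]
  exact (Complex.coe_smul _ _).symm

/-- A Schwartz function, as an element of the form domain. -/
def schwartzQ (f : 𝓢(Pos M, Spinor N)) : Q₀ M N := ⟨f.toLp 2, toLp_mem_Q₀ f⟩

theorem dQ_schwartzQ (m : Fin M) (f : 𝓢(Pos M, Spinor N)) :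
    dQ m (schwartzQ f) = (∂_{EuclideanSpace.single m (1 : ℝ)} f).toLp 2 :=
  dQ_eq_of_toDist (lineDeriv_toDist_toLp f _)

/-- `Q₀` contains the Schwartz functions, which are dense in `L²`. By continuity the real part of
the pairing vanishes on all of `L²`, in particular at `h` itself. -/
theorem eq_zero_of_re_inner_Q₀ {h : Hilb M N}
    (hh : ∀ χ : Q₀ M N, (inner ℂ h (χ : Hilb M N)).re = 0) : h = 0 := by
  have hd : DenseRange (SchwartzMap.toLpCLM ℝ (Spinor N) 2 (volume : Measure (Pos M))) :=
    SchwartzMap.denseRange_toLpCLM (by simp)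
  have : (fun g : Hilb M N => (inner ℂ h g).re) = fun _ => 0 := by
    refine hd.equalizer (by fun_prop) continuous_const ?_
    funext f
    exact hh (schwartzQ f)
  have h0 := congrFun this h
  simp only [inner_self_eq_norm_sq_to_K] at h0
  have : ‖h‖ ^ 2 = 0 := by exact_mod_cast h0
  simpa using this

/-- The Schwartz function `x ↦ conj (φ x) • e`. -/
def conjSmul (φ : 𝓢(Pos M, ℂ)) (e : Spinor N) : 𝓢(Pos M, Spinor N) :=
  SchwartzMap.postcompCLM (𝕜 := ℝ)
    (((ContinuousLinearMap.toSpanSingleton ℂ e).restrictScalars ℝ).comp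
      (Complex.conjCLE : ℂ →L[ℝ] ℂ)) φ

theorem conjSmul_apply (φ : 𝓢(Pos M, ℂ)) (e : Spinor N) (x : Pos M) :
    conjSmul φ e x = (starRingEnd ℂ) (φ x) • e := by
  simp [conjSmul]

theorem lineDeriv_conjSmul (φ : 𝓢(Pos M, ℂ)) (e : Spinor N) (v : Pos M) :
    ∂_{v} (conjSmul φ e) = conjSmul (∂_{v} φ) e := by
  ext1 x
  rw [SchwartzMap.lineDerivOp_apply_eq_fderiv]
  have h : HasFDerivAt (conjSmul φ e) ((((ContinuousLinearMap.toSpanSingleton ℂ e).restrictScalars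
      ℝ).comp (Complex.conjCLE : ℂ →L[ℝ] ℂ)).comp (fderiv ℝ φ x)) x :=
    (ContinuousLinearMap.hasFDerivAt _).comp x (φ.hasFDerivAt x)
  rw [h.fderiv, conjSmul_apply, SchwartzMap.lineDerivOp_apply_eq_fderiv]
  simp

/-- Translates weak identities on `Q₀` into identities of tempered distributions. The conjugate in
the test function offsets conjugate-linearity in the first slot. -/
theorem inner_conjSmul_toLp (φ : 𝓢(Pos M, ℂ)) (e : Spinor N) (h : Hilb M N) :
    inner ℂ ((conjSmul φ e).toLp 2) h = inner ℂ e (toDist M N h φ) := by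
  have hintegr : Integrable (fun x => φ x • h x) volume := by
    have h2 := (φ.memLp 2 volume)
    exact memLp_one_iff_integrable.1 ((Lp.memLp h).smul h2)
  rw [toDist_apply, ← integral_inner hintegr, L2.inner_def]
  refine integral_congr_ae ?_
  filter_upwards [(conjSmul φ e).coeFn_toLp 2 volume] with x hx
  rw [hx, conjSmul_apply, inner_smul_left, inner_smul_right, Complex.conj_conj]

/-! ### Multiplication of form domain elements by smooth functions -/

theorem memLp_bdd_smul {w : Pos M → ℝ} (hw : Continuous w) {C : ℝ} (hC : ∀ x, |w x| ≤ C)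
    (u : Hilb M N) : MemLp (fun x => (w x : ℂ) • u x) 2 volume := by
  refine (Lp.memLp u).of_le_mul (c := C) ?_ (Filter.Eventually.of_forall fun x => ?_)
  · exact (Complex.continuous_ofReal.comp hw).aestronglyMeasurable.smul (Lp.aestronglyMeasurable u)
  · rw [norm_smul, Complex.norm_real, Real.norm_eq_abs]
    exact mul_le_mul_of_nonneg_right (hC x) (norm_nonneg _)

theorem exists_coeFn_eq {f : Pos M → Spinor N} (hf : MemLp f 2 volume) :
    ∃ h : Hilb M N, h =ᵐ[volume] f :=
  ⟨hf.toLp f, hf.coeFn_toLp⟩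

/-- The weak product rule. -/
theorem lineDeriv_toDist_smul {w w' : Pos M → ℝ} {v : Pos M} (hw : w.HasTemperateGrowth)
    (hw' : w'.HasTemperateGrowth) (hd : ∀ x, fderiv ℝ w x v = w' x) {u g wu h : Hilb M N}
    (hg : ∂_{v} (toDist M N u) = toDist M N g)
    (hwu : wu =ᵐ[volume] fun x => (w x : ℂ) • u x)
    (hh : h =ᵐ[volume] fun x => (w x : ℂ) • g x + (w' x : ℂ) • u x) :
    ∂_{v} (toDist M N wu) = toDist M N h := by
  have hintegr : ∀ (φ : 𝓢(Pos M, ℂ)) (k : Hilb M N), Integrable (fun x => φ x • k x) volume :=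
    fun φ k => memLp_one_iff_integrable.1 ((Lp.memLp k).smul (φ.memLp 2 volume))
  ext1 φ
  have hsm : ∀ (a : Pos M → ℝ), a.HasTemperateGrowth → ∀ (θ : 𝓢(Pos M, ℂ)) (x : Pos M),
      SchwartzMap.smulLeftCLM ℂ a θ x = (a x : ℂ) * θ x := fun a ha θ x => by
    rw [SchwartzMap.smulLeftCLM_apply_apply ha]; exact Complex.real_smul
  have h1 : ∀ x, (∂_{v} (SchwartzMap.smulLeftCLM ℂ w φ)) x =
      (w x : ℂ) * (∂_{v} φ) x + (w' x : ℂ) * φ x := by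
    intro x
    rw [SchwartzMap.lineDerivOp_apply_eq_fderiv, SchwartzMap.lineDerivOp_apply_eq_fderiv]
    have hwd : HasFDerivAt w (fderiv ℝ w x) x :=
      ((hw.1.differentiable (by simp)) x).hasFDerivAt
    have hf : HasFDerivAt (fun x => w x • φ x) _ x := hwd.smul (φ.hasFDerivAt x)
    have heq : (SchwartzMap.smulLeftCLM ℂ w φ : Pos M → ℂ) = fun x => w x • φ x :=
      SchwartzMap.smulLeftCLM_apply hw φ
    rw [heq, hf.fderiv]
    simp [hd]
  -- The weak derivative of `u` is tested against `w φ`; the classical product rule for `w φ` does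
  -- the rest.
  have hgφ := congrArg (fun T : 𝓢'(Pos M, Spinor N) => T (SchwartzMap.smulLeftCLM ℂ w φ)) hg
  simp only [TemperedDistribution.lineDerivOp_apply_apply] at hgφ ⊢
  rw [map_neg, toDist_apply] at hgφ
  rw [map_neg, toDist_apply, toDist_apply]
  rw [toDist_apply] at hgφ
  have e1 : ∫ x, (∂_{v} (SchwartzMap.smulLeftCLM ℂ w φ)) x • u x =
      (∫ x, (∂_{v} φ) x • wu x) + ∫ x, SchwartzMap.smulLeftCLM ℂ w' φ x • u x := by
    rw [← integral_add (hintegr _ _) (hintegr _ _)]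
    refine integral_congr_ae ?_
    filter_upwards [hwu] with x hx
    rw [hx, h1, hsm w' hw', add_smul, smul_smul, mul_comm (w x : ℂ)]
  have e2 : ∫ x, φ x • h x = (∫ x, SchwartzMap.smulLeftCLM ℂ w φ x • g x) +
      ∫ x, SchwartzMap.smulLeftCLM ℂ w' φ x • u x := by
    rw [← integral_add (hintegr _ _) (hintegr _ _)]
    refine integral_congr_ae ?_
    filter_upwards [hh] with x hx
    rw [hx, hsm w' hw', hsm w hw, smul_add, smul_smul, smul_smul, mul_comm (φ x), mul_comm (φ x)]
  rw [e2, ← hgφ, e1]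
  abel

/-- The form domain is stable under multiplication by bounded functions with bounded derivatives. -/
theorem exists_mul_Q₀ {w : Pos M → ℝ} {w' : Fin M → Pos M → ℝ} (hw : w.HasTemperateGrowth)
    (hw' : ∀ m, (w' m).HasTemperateGrowth)
    (hd : ∀ m x, fderiv ℝ w x (EuclideanSpace.single m 1) = w' m x)
    {C : ℝ} (hC : ∀ x, |w x| ≤ C) (hC' : ∀ m x, |w' m x| ≤ C) (u : Q₀ M N) :
    ∃ χ : Q₀ M N, (χ : Hilb M N) =ᵐ[volume] (fun x => (w x : ℂ) • (u : Hilb M N) x) ∧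
      ∀ m, dQ m χ =ᵐ[volume]
        fun x => (w x : ℂ) • dQ m u x + (w' m x : ℂ) • (u : Hilb M N) x := by
  have hc : Continuous w := hw.1.continuous
  have hc' : ∀ m, Continuous (w' m) := fun m => (hw' m).1.continuous
  obtain ⟨k, hk⟩ := exists_coeFn_eq (memLp_bdd_smul hc hC (u : Hilb M N))
  have hex : ∀ m, ∃ h : Hilb M N, h =ᵐ[volume]
      fun x => (w x : ℂ) • dQ m u x + (w' m x : ℂ) • (u : Hilb M N) x := fun m =>
    exists_coeFn_eq ((memLp_bdd_smul hc hC (dQ m u)).add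
      (memLp_bdd_smul (hc' m) (hC' m) (u : Hilb M N)))
  choose h hh using hex
  have hder : ∀ m, ∂_{EuclideanSpace.single m (1 : ℝ)} (toDist M N k) = toDist M N (h m) :=
    fun m => lineDeriv_toDist_smul hw (hw' m) (hd m) (toDist_dQ m u).symm hk (hh m)
  have hmem : k ∈ Q₀ M N := by
    refine mem_Q₀_iff.2 fun m => ⟨⟨_, hder m⟩, ?_⟩
    refine (memLp_congr_ae ?_).1 (memLp_bdd_smul hc hC (xQ m u))
    filter_upwards [hk, coeFn_xQ m u] with x h1 h2
    rw [h1, h2, smul_comm]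
  refine ⟨⟨k, hmem⟩, hk, fun m => ?_⟩
  rw [dQ_eq_of_toDist (ψ := ⟨k, hmem⟩) (hder m)]
  exact hh m

end FormDomain

/-! ### Regularity of weak solutions -/

section Regularity

variable {M N : ℕ}

/-- A bounded approximation of `‖x‖²`. -/
def cutoff (M : ℕ) (δ : ℝ) (x : Pos M) : ℝ := ‖x‖ ^ 2 * (1 + δ ^ 2 * ‖x‖ ^ 2)⁻¹

/-- The `m`-th partial derivative of `cutoff`. -/
def cutoffDeriv (δ : ℝ) (m : Fin M) (x : Pos M) : ℝ :=
  2 * x m * ((1 + δ ^ 2 * ‖x‖ ^ 2)⁻¹ * (1 + δ ^ 2 * ‖x‖ ^ 2)⁻¹)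

theorem hasTemperateGrowth_inv_one_add (δ : ℝ) :
    (fun x : Pos M => (1 + δ ^ 2 * ‖x‖ ^ 2)⁻¹).HasTemperateGrowth := by
  have h := (Function.hasTemperateGrowth_one_add_norm_sq_rpow (H := Pos M) (-1)).comp
    (δ • ContinuousLinearMap.id ℝ (Pos M)).hasTemperateGrowth
  have heq : (fun x : Pos M => (1 + δ ^ 2 * ‖x‖ ^ 2)⁻¹) =
      (fun x : Pos M => (1 + ‖x‖ ^ 2) ^ (-1 : ℝ)) ∘ (δ • ContinuousLinearMap.id ℝ (Pos M)) := by
    funext x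
    simp [norm_smul, mul_pow, Real.rpow_neg_one]
  rw [heq]
  exact h

theorem hasTemperateGrowth_cutoff (δ : ℝ) : (cutoff M δ).HasTemperateGrowth :=
  (Function.hasTemperateGrowth_norm_sq (Pos M)).mul (hasTemperateGrowth_inv_one_add δ)

theorem hasTemperateGrowth_cutoffDeriv (δ : ℝ) (m : Fin M) :
    (cutoffDeriv δ m).HasTemperateGrowth :=
  ((Function.HasTemperateGrowth.const 2).mul (hasTemperateGrowth_coord m)).mul
    ((hasTemperateGrowth_inv_one_add δ).mul (hasTemperateGrowth_inv_one_add δ))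

theorem one_add_pos (δ : ℝ) (x : Pos M) : 0 < 1 + δ ^ 2 * ‖x‖ ^ 2 := by positivity

theorem fderiv_cutoff (δ : ℝ) (m : Fin M) (x : Pos M) :
    fderiv ℝ (cutoff M δ) x (EuclideanSpace.single m 1) = cutoffDeriv δ m x := by
  have hp := one_add_pos δ x
  have h1 : HasDerivAt (fun s : ℝ => s * (1 + δ ^ 2 * s)⁻¹)
      ((1 + δ ^ 2 * ‖x‖ ^ 2)⁻¹ * (1 + δ ^ 2 * ‖x‖ ^ 2)⁻¹) (‖x‖ ^ 2) := by
    have h2 : HasDerivAt (fun s : ℝ => 1 + δ ^ 2 * s) (δ ^ 2) (‖x‖ ^ 2) := by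
      simpa using ((hasDerivAt_id (‖x‖ ^ 2)).const_mul (δ ^ 2)).const_add 1
    refine ((hasDerivAt_id (‖x‖ ^ 2)).mul (h2.inv hp.ne')).congr_deriv ?_
    simp only [id, Pi.inv_apply]
    field_simp
    ring
  have h3 := h1.comp_hasFDerivAt x (hasStrictFDerivAt_norm_sq x).hasFDerivAt
  have h4 : HasFDerivAt (cutoff M δ) _ x := h3
  rw [h4.fderiv]
  simp only [cutoffDeriv, _root_.smul_apply, innerSL_apply_apply, smul_eq_mul,
    EuclideanSpace.inner_single_right]
  simp
  ring

theorem cutoff_nonneg (δ : ℝ) (x : Pos M) : 0 ≤ cutoff M δ x :=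
  mul_nonneg (by positivity) (inv_nonneg.2 (one_add_pos δ x).le)

theorem inv_one_add_le_one (δ : ℝ) (x : Pos M) : (1 + δ ^ 2 * ‖x‖ ^ 2)⁻¹ ≤ 1 :=
  inv_le_one_of_one_le₀ (by nlinarith [sq_nonneg (δ * ‖x‖)])

theorem cutoff_le (δ : ℝ) (x : Pos M) : cutoff M δ x ≤ ‖x‖ ^ 2 :=
  mul_le_of_le_one_right (by positivity) (inv_one_add_le_one δ x)

/-- The bound does not depend on `δ`, and its right side is controlled by the form domain norm. This
is what makes the later `L²` estimate uniform. -/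
theorem abs_cutoffDeriv_le (δ : ℝ) (m : Fin M) (x : Pos M) :
    |cutoffDeriv δ m x| ≤ 2 * |x m| := by
  have h0 := inv_nonneg.2 (one_add_pos δ x).le
  have h1 := inv_one_add_le_one δ x
  rw [cutoffDeriv, abs_mul, abs_mul, abs_two, abs_of_nonneg (mul_nonneg h0 h0)]
  exact mul_le_of_le_one_right (by positivity) (mul_le_one₀ h1 h0 h1)

/-- These bounds degenerate as `δ → 0`; they serve only to make the truncated function an admissible
test function in `Q₀`. -/
theorem cutoff_bounded {δ : ℝ} (hδ : 0 < δ) :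
    ∃ C : ℝ, (∀ x : Pos M, |cutoff M δ x| ≤ C) ∧ ∀ m (x : Pos M), |cutoffDeriv δ m x| ≤ C := by
  refine ⟨(δ ^ 2)⁻¹ + δ⁻¹, fun x => ?_, fun m x => ?_⟩
  · rw [abs_of_nonneg (cutoff_nonneg δ x)]
    have : cutoff M δ x ≤ (δ ^ 2)⁻¹ := by
      rw [cutoff, ← div_eq_mul_inv, div_le_iff₀ (one_add_pos δ x)]
      field_simp
      linarith
    have := inv_pos.2 hδ
    linarith
  · have h0 := inv_nonneg.2 (one_add_pos δ x).le
    have h1 := inv_one_add_le_one δ x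
    have hxm : |x m| ≤ ‖x‖ := PiLp.norm_apply_le x m
    have h2 : ‖x‖ * (1 + δ ^ 2 * ‖x‖ ^ 2)⁻¹ * 2 ≤ δ⁻¹ := by
      rw [mul_assoc, mul_comm _ (2 : ℝ), ← mul_assoc, ← div_eq_mul_inv,
        div_le_iff₀ (one_add_pos δ x)]
      have : δ⁻¹ * (1 + δ ^ 2 * ‖x‖ ^ 2) - ‖x‖ * 2 = δ⁻¹ * (1 - δ * ‖x‖) ^ 2 := by
        field_simp; ring
      have : 0 ≤ δ⁻¹ * (1 - δ * ‖x‖) ^ 2 := by positivity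
      linarith
    rw [cutoffDeriv, abs_mul, abs_mul, abs_two, abs_of_nonneg (mul_nonneg h0 h0)]
    have h3 : 0 < (δ ^ 2)⁻¹ := by positivity
    set r := (1 + δ ^ 2 * ‖x‖ ^ 2)⁻¹
    have h4 : 2 * |x m| * (r * r) ≤ 2 * ‖x‖ * (r * 1) := by gcongr
    linarith

/-- If `(-Δ + |x|²) u = f` weakly with `u` in the form domain and `f ∈ L²`, then `cutoff • u` is
bounded in `L²` uniformly in the cutoff parameter. -/
theorem norm_cutoff_smul_le (u : Q₀ M N) (f : Hilb M N)
    (hweak : ∀ χ : Q₀ M N, ∑ m, (inner ℂ (dQ m u) (dQ m χ)).re +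
      ∑ m, (inner ℂ (xQ m u) (xQ m χ)).re = (inner ℂ f (χ : Hilb M N)).re)
    {δ : ℝ} (hδ : 0 < δ) :
    ∃ χ : Hilb M N, χ =ᵐ[volume] (fun x => (cutoff M δ x : ℂ) • (u : Hilb M N) x) ∧
      ‖χ‖ ^ 2 ≤ ‖f‖ ^ 2 + 2 * ∑ m, (‖dQ m u‖ ^ 2 + ‖xQ m u‖ ^ 2) := by
  obtain ⟨C, hC, hC'⟩ := cutoff_bounded (M := M) hδ
  obtain ⟨χ, hχ, hdχ⟩ := exists_mul_Q₀ (hasTemperateGrowth_cutoff δ)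
    (hasTemperateGrowth_cutoffDeriv δ) (fderiv_cutoff δ) hC hC' u
  refine ⟨χ, hχ, ?_⟩
  have hintegr : ∀ a b : Hilb M N, Integrable (fun x => (inner ℂ (a x) (b x)).re) volume :=
    fun a b => (L2.integrable_inner (𝕜 := ℂ) a b).re
  have hre : ∀ a b : Hilb M N, (inner ℂ a b).re = ∫ x, (inner ℂ (a x) (b x)).re := fun a b => by
    rw [L2.inner_def]
    exact (integral_re (L2.integrable_inner (𝕜 := ℂ) a b)).symm
  have hsq : ∀ a : Hilb M N, ‖a‖ ^ 2 = (inner ℂ a a).re := fun a =>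
    (inner_self_eq_norm_sq (𝕜 := ℂ) a).symm
  -- With `χ = w u`, the term `w |∂_m u|²` is nonnegative, and the cross term is at most `2 |x_m|
  -- |u| |∂_m u| ≤ |∂_m u|² + |x_m u|²`.
  have h1 : ∀ m, -(‖dQ m u‖ ^ 2 + ‖xQ m u‖ ^ 2) ≤ (inner ℂ (dQ m u) (dQ m χ)).re := by
    intro m
    rw [hsq, hsq, hre, hre, hre, ← integral_add (hintegr _ _) (hintegr _ _), ← integral_neg]
    refine integral_mono_ae ((hintegr _ _).add (hintegr _ _)).neg (hintegr _ _) ?_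
    filter_upwards [hdχ m, coeFn_xQ m u] with x hx1 hx2
    rw [hx1, hx2]
    have e1 : (inner ℂ (dQ m u x) (dQ m u x)).re = ‖dQ m u x‖ ^ 2 := inner_self_eq_norm_sq (𝕜 := ℂ) _
    have e2 : (inner ℂ (((x m : ℝ) : ℂ) • (u : Hilb M N) x)
        (((x m : ℝ) : ℂ) • (u : Hilb M N) x)).re = (|x m| * ‖(u : Hilb M N) x‖) ^ 2 := by
      rw [← Real.norm_eq_abs, ← Complex.norm_real, ← norm_smul]
      exact inner_self_eq_norm_sq (𝕜 := ℂ) _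
    rw [e1, e2, inner_add_right, inner_smul_right, inner_smul_right, Complex.add_re,
      Complex.re_ofReal_mul, Complex.re_ofReal_mul, e1]
    have h2 : |(inner ℂ (dQ m u x) ((u : Hilb M N) x)).re| ≤ ‖dQ m u x‖ * ‖(u : Hilb M N) x‖ :=
      (Complex.abs_re_le_norm _).trans (norm_inner_le_norm _ _)
    have h3 : |cutoffDeriv δ m x * (inner ℂ (dQ m u x) ((u : Hilb M N) x)).re| ≤
        2 * |x m| * (‖dQ m u x‖ * ‖(u : Hilb M N) x‖) := by
      rw [abs_mul]
      exact mul_le_mul (abs_cutoffDeriv_le δ m x) h2 (abs_nonneg _) (by positivity)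
    have h4 := neg_abs_le (cutoffDeriv δ m x * (inner ℂ (dQ m u x) ((u : Hilb M N) x)).re)
    have h5 : 0 ≤ cutoff M δ x * ‖dQ m u x‖ ^ 2 :=
      mul_nonneg (cutoff_nonneg δ x) (by positivity)
    nlinarith [sq_nonneg (‖dQ m u x‖ - |x m| * ‖(u : Hilb M N) x‖)]
  -- Pointwise this is `w² |u|² ≤ |x|² w |u|²`, from `0 ≤ w ≤ |x|²`.
  have h2 : ‖(χ : Hilb M N)‖ ^ 2 ≤ ∑ m, (inner ℂ (xQ m u) (xQ m χ)).re := by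
    simp only [hsq, hre]
    rw [← integral_finsetSum _ fun m _ => hintegr _ _]
    refine integral_mono_ae (hintegr _ _) (integrable_finsetSum _ fun m _ => hintegr _ _) ?_
    have hall : ∀ᵐ x ∂(volume : Measure (Pos M)), ∀ m,
        xQ m u x = ((x m : ℝ) : ℂ) • (u : Hilb M N) x ∧
        xQ m χ x = ((x m : ℝ) : ℂ) • (χ : Hilb M N) x :=
      ae_all_iff.2 fun m => (coeFn_xQ m u).and (coeFn_xQ m χ)
    filter_upwards [hall, hχ] with x hx hx2
    have e1 : ∀ m, (inner ℂ (xQ m u x) (xQ m χ x)).re =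
        x m ^ 2 * (cutoff M δ x * ‖(u : Hilb M N) x‖ ^ 2) := by
      intro m
      rw [(hx m).1, (hx m).2, hx2, inner_smul_left, inner_smul_right, inner_smul_right,
        Complex.conj_ofReal, Complex.re_ofReal_mul, Complex.re_ofReal_mul, Complex.re_ofReal_mul]
      have : (inner ℂ ((u : Hilb M N) x) ((u : Hilb M N) x)).re = ‖(u : Hilb M N) x‖ ^ 2 :=
        inner_self_eq_norm_sq (𝕜 := ℂ) _
      rw [this]; ring
    have e2 : (inner ℂ ((χ : Hilb M N) x) ((χ : Hilb M N) x)).re =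
        cutoff M δ x * (cutoff M δ x * ‖(u : Hilb M N) x‖ ^ 2) := by
      have : (inner ℂ ((χ : Hilb M N) x) ((χ : Hilb M N) x)).re = ‖(χ : Hilb M N) x‖ ^ 2 :=
        inner_self_eq_norm_sq (𝕜 := ℂ) _
      rw [this, hx2, norm_smul, Complex.norm_real, mul_pow, Real.norm_eq_abs, sq_abs]; ring
    simp only [e1, e2]
    rw [← Finset.sum_mul]
    refine mul_le_mul_of_nonneg_right ?_ (mul_nonneg (cutoff_nonneg δ x) (by positivity))
    refine (cutoff_le δ x).trans_eq ?_
    rw [EuclideanSpace.norm_sq_eq]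
    simp
  have h3 : (inner ℂ f (χ : Hilb M N)).re ≤ ‖f‖ * ‖(χ : Hilb M N)‖ :=
    (Complex.re_le_norm _).trans (norm_inner_le_norm _ _)
  have h4 := Finset.sum_le_sum fun m (_ : m ∈ Finset.univ) => h1 m
  rw [Finset.sum_neg_distrib] at h4
  have h5 := hweak χ
  -- Young's inequality absorbs `‖f‖ ‖χ‖` into half of `‖χ‖²`.
  nlinarith [sq_nonneg (‖f‖ - ‖(χ : Hilb M N)‖)]

theorem tendsto_cutoff (x : Pos M) :
    Filter.Tendsto (fun k : ℕ => cutoff M (1 / ((k : ℝ) + 1)) x) Filter.atTop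
      (nhds (‖x‖ ^ 2)) := by
  have h0 := tendsto_one_div_add_atTop_nhds_zero_nat (𝕜 := ℝ)
  have hc : ContinuousAt (fun δ : ℝ => cutoff M δ x) 0 := by
    unfold cutoff
    have : (1 + (0 : ℝ) ^ 2 * ‖x‖ ^ 2) ≠ 0 := by simp
    exact continuousAt_const.mul (ContinuousAt.inv₀ (by fun_prop) this)
  have h1 : cutoff M 0 x = ‖x‖ ^ 2 := by simp [cutoff]
  rw [← h1]
  exact hc.tendsto.comp h0

/-- Fatou: the truncations with `δ = 1 / (k + 1)` converge pointwise to `|x|² u`, and their `L²`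
norms are bounded uniformly in `k`. -/
theorem memLp_norm_sq_smul (u : Q₀ M N) (f : Hilb M N)
    (hweak : ∀ χ : Q₀ M N, ∑ m, (inner ℂ (dQ m u) (dQ m χ)).re +
      ∑ m, (inner ℂ (xQ m u) (xQ m χ)).re = (inner ℂ f (χ : Hilb M N)).re) :
    MemLp (fun x => ((‖x‖ ^ 2 : ℝ) : ℂ) • (u : Hilb M N) x) 2 volume := by
  choose χ hχ hbd using fun k : ℕ => norm_cutoff_smul_le u f hweak
    (δ := 1 / ((k : ℝ) + 1)) Nat.one_div_pos_of_nat
  set K := ‖f‖ ^ 2 + 2 * ∑ m, (‖dQ m u‖ ^ 2 + ‖xQ m u‖ ^ 2)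
  have hmeas : AEStronglyMeasurable (fun x => ((‖x‖ ^ 2 : ℝ) : ℂ) • (u : Hilb M N) x) volume :=
    (Complex.continuous_ofReal.comp (by fun_prop : Continuous fun x : Pos M => ‖x‖ ^ 2)
      ).aestronglyMeasurable.smul (Lp.aestronglyMeasurable _)
  refine ⟨hmeas, ?_⟩
  have hle := Lp.eLpNorm_lim_le_liminf_eLpNorm (p := 2) (μ := (volume : Measure (Pos M)))
    (f := fun k => (χ k : Pos M → Spinor N)) (fun k => Lp.aestronglyMeasurable _)
    (fun x => ((‖x‖ ^ 2 : ℝ) : ℂ) • (u : Hilb M N) x) (by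
      filter_upwards [ae_all_iff.2 hχ] with x hx
      simp only [hx]
      exact ((Complex.continuous_ofReal.tendsto _).comp (tendsto_cutoff x)).smul_const _)
  refine lt_of_le_of_lt hle (lt_of_le_of_lt (b := ENNReal.ofReal (Real.sqrt K)) ?_
    ENNReal.ofReal_lt_top)
  refine Filter.liminf_le_of_le (by isBoundedDefault) fun b hb => ?_
  obtain ⟨k, hk⟩ := hb.exists
  refine hk.trans ?_
  rw [← ENNReal.ofReal_toReal (Lp.eLpNorm_ne_top (χ k)), ← Lp.norm_def]
  exact ENNReal.ofReal_le_ofReal (Real.le_sqrt_of_sq_le (hbd k))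

/-- A weak solution of `(-Δ + |x|²) u = f` in the form domain is a strong solution. -/
theorem strong_of_weak (u : Q₀ M N) (f : Hilb M N)
    (hweak : ∀ χ : Q₀ M N, ∑ m, (inner ℂ (dQ m u) (dQ m χ)).re +
      ∑ m, (inner ℂ (xQ m u) (xQ m χ)).re = (inner ℂ f (χ : Hilb M N)).re) :
    ∃ (h₁ : (u : Hilb M N) ∈ (laplace M N).domain)
      (h₂ : (u : Hilb M N) ∈ (mulOp M N fun x => ‖x‖ ^ 2).domain),
      -laplace M N ⟨u, h₁⟩ + mulOp M N (fun x => ‖x‖ ^ 2) ⟨u, h₂⟩ = f := by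
  have h₂ : (u : Hilb M N) ∈ (mulOp M N fun x => ‖x‖ ^ 2).domain := memLp_norm_sq_smul u f hweak
  set X := mulOp M N (fun x => ‖x‖ ^ 2) ⟨u, h₂⟩ with hX
  have hXae : X =ᵐ[volume] fun x => ((‖x‖ ^ 2 : ℝ) : ℂ) • (u : Hilb M N) x :=
    MemLp.coeFn_toLp h₂
  -- Testing with `Complex.I • χ` recovers the imaginary part, so the real weak equation is already
  -- the complex one.
  have hweakC : ∀ χ : Q₀ M N, ∑ m, inner ℂ (dQ m χ) (dQ m u) +
      ∑ m, inner ℂ (xQ m χ) (xQ m u) = inner ℂ (χ : Hilb M N) f := by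
    intro χ
    have r1 := hweak χ
    have r2 := hweak (Complex.I • χ)
    simp only [dQ_smul, xQ_smul, Submodule.coe_smul, inner_smul_right, Complex.I_mul_re,
      Finset.sum_neg_distrib] at r2
    have s : ∀ a b : Hilb M N, inner ℂ a b = (starRingEnd ℂ) (inner ℂ b a) := fun a b =>
      (inner_conj_symm a b).symm
    apply Complex.ext
    · simp only [Complex.add_re, Complex.re_sum]
      simp only [s (dQ _ χ), s (xQ _ χ), s (χ : Hilb M N), Complex.conj_re]
      exact r1
    · simp only [Complex.add_im, Complex.im_sum]
      simp only [s (dQ _ χ), s (xQ _ χ), s (χ : Hilb M N), Complex.conj_im, Finset.sum_neg_distrib]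
      linarith
  have hxX : ∀ χ : Q₀ M N, ∑ m, inner ℂ (xQ m χ) (xQ m u) = inner ℂ (χ : Hilb M N) X := by
    intro χ
    simp only [L2.inner_def]
    rw [← integral_finsetSum _ fun m _ => L2.integrable_inner (𝕜 := ℂ) (xQ m χ) (xQ m u)]
    refine integral_congr_ae ?_
    have hall : ∀ᵐ x ∂(volume : Measure (Pos M)), ∀ m,
        xQ m u x = ((x m : ℝ) : ℂ) • (u : Hilb M N) x ∧
        xQ m χ x = ((x m : ℝ) : ℂ) • (χ : Hilb M N) x :=
      ae_all_iff.2 fun m => (coeFn_xQ m u).and (coeFn_xQ m χ)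
    filter_upwards [hall, hXae] with x hx hx2
    rw [hx2, inner_smul_right, EuclideanSpace.norm_sq_eq]
    simp only [(hx _).1, (hx _).2, inner_smul_left, inner_smul_right, Complex.conj_ofReal]
    push_cast
    rw [Finset.sum_mul]
    refine Finset.sum_congr rfl fun m _ => ?_
    rw [← mul_assoc, ← Complex.ofReal_mul, ← Complex.ofReal_pow, Real.norm_eq_abs, sq_abs, sq]
  -- Equality of vector-valued distributions is checked after pairing with each spinor `e`, that is,
  -- on the Schwartz test functions `conj φ • e`.
  have hΔ : Δ (toDist M N (u : Hilb M N)) = toDist M N (X - f) := by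
    ext1 φ
    refine ext_inner_left ℂ fun e => ?_
    have hχ := hweakC (schwartzQ (conjSmul φ e))
    rw [hxX] at hχ
    simp only [dQ_schwartzQ, lineDeriv_conjSmul] at hχ
    simp only [inner_conjSmul_toLp, schwartzQ, toDist_dQ] at hχ
    rw [TemperedDistribution.laplacian_eq_sum (EuclideanSpace.basisFun (Fin M) ℝ), map_sub]
    have e1 : (∑ i, ∂_{EuclideanSpace.basisFun (Fin M) ℝ i}
        (∂_{EuclideanSpace.basisFun (Fin M) ℝ i} (toDist M N (u : Hilb M N)))) φ =
        ∑ i, (∂_{EuclideanSpace.basisFun (Fin M) ℝ i}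
        (∂_{EuclideanSpace.basisFun (Fin M) ℝ i} (toDist M N (u : Hilb M N)))) φ := by
      simp
    have e2 : (toDist M N X - toDist M N f) φ = toDist M N X φ - toDist M N f φ := rfl
    rw [e1, e2, inner_sub_right, ← hχ, inner_sum]
    simp only [EuclideanSpace.basisFun_apply, TemperedDistribution.lineDerivOp_apply_apply, map_neg,
      inner_neg_right, Finset.sum_neg_distrib]
    ring
  have h₁ : (u : Hilb M N) ∈ (laplace M N).domain :=
    ⟨X - f, (TemperedDistribution.laplacianCLM_apply _).trans hΔ⟩
  refine ⟨h₁, h₂, ?_⟩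
  have hL : laplace M N ⟨u, h₁⟩ = X - f := by
    apply toDist_injective M N
    have := partOp_spec (toDist M N).toLinearMap (toDist_injective M N)
      (LineDeriv.laplacianCLM ℂ (Pos M) 𝓢'(Pos M, Spinor N)).toLinearMap ⟨u, h₁⟩
    exact this.trans ((TemperedDistribution.laplacianCLM_apply _).trans hΔ)
  rw [hL]
  abel

end Regularity

/-! ### Independence of the constraints at regular magnetizations -/

section Constraints

variable {M N : ℕ}

theorem lift_pauliZ_eq_diagonal (n : Fin N) :
    lift pauliZ n = Matrix.diagonal fun α => ((Omega N n α : ℝ) : ℂ) := by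
  have hentry : ∀ i k : Fin 2, i ≠ k → pauliZ i k = 0 := by
    intro i k h; fin_cases i <;> fin_cases k <;> simp_all [pauliZ]
  have hre : ∀ i : Fin 2, (starRingEnd ℂ) (pauliZ i i) = pauliZ i i := by
    intro i; fin_cases i <;> simp [pauliZ]
  ext α β
  by_cases h : α = β
  · subst h
    rw [Matrix.diagonal_apply_eq, Omega, Matrix.of_apply, eq_comm, ← Complex.conj_eq_iff_re]
    simp only [lift, Matrix.of_apply, map_prod]
    refine Finset.prod_congr rfl fun i _ => ?_
    by_cases hi : i = n
    · simp only [hi, if_true]; exact hre _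
    · simp [hi]
  · rw [Matrix.diagonal_apply_ne _ h]
    obtain ⟨i, hi⟩ := Function.ne_iff.1 h
    refine Finset.prod_eq_zero (Finset.mem_univ i) ?_
    by_cases hn : i = n
    · simp only [hn, if_true]; exact hentry _ _ (hn ▸ hi)
    · simp only [hn, if_false]; exact Matrix.one_apply_ne hi

theorem coeFn_sigmaZ (n : Fin N) (ψ : Hilb M N) :
    ∀ᵐ x ∂(volume : Measure (Pos M)), ∀ α,
      sigmaZ M n ψ x α = ((Omega N n α : ℝ) : ℂ) * ψ x α := by
  filter_upwards [coeFn_spinOp (lift pauliZ n) ψ] with x hx α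
  rw [sigmaZ, hx, lift_pauliZ_eq_diagonal]
  exact Matrix.mulVec_diagonal _ _ _

/-- The weight of the spin configuration `α` in the state `ψ`. -/
def spinWeight (ψ : Hilb M N) (α : Spin N) : ℝ := ∫ x, ‖ψ x α‖ ^ 2

theorem integrable_norm_sq_component (ψ : Hilb M N) (α : Spin N) :
    Integrable (fun x => ‖ψ x α‖ ^ 2) volume := by
  have h : MemLp (fun x => ψ x α) 2 volume :=
    (EuclideanSpace.proj (𝕜 := ℂ) α : Spinor N →L[ℂ] ℂ).comp_memLp' (Lp.memLp ψ)
  exact h.integrable_norm_pow (by norm_num)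

theorem sum_spinWeight (ψ : Hilb M N) : ∑ α, spinWeight ψ α = ‖ψ‖ ^ 2 := by
  have h1 : ‖ψ‖ ^ 2 = (inner ℂ ψ ψ).re := (inner_self_eq_norm_sq (𝕜 := ℂ) ψ).symm
  have h2 : (inner ℂ ψ ψ).re = ∫ x, (inner ℂ (ψ x) (ψ x)).re := by
    rw [L2.inner_def]
    exact (integral_re (L2.integrable_inner (𝕜 := ℂ) ψ ψ)).symm
  rw [h1, h2]
  simp only [spinWeight]
  rw [← integral_finsetSum _ fun α _ => integrable_norm_sq_component ψ α]
  refine integral_congr_ae (Filter.Eventually.of_forall fun x => ?_)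
  have : (inner ℂ (ψ x) (ψ x)).re = ‖ψ x‖ ^ 2 := inner_self_eq_norm_sq (𝕜 := ℂ) _
  simp only [this]
  rw [EuclideanSpace.norm_sq_eq]

/-- With `sum_spinWeight`, this makes the spin weights of a normalized state an admissible `ω` in
the definition of `IsRegular`. -/
theorem Omega_mulVec_spinWeight (ψ : Hilb M N) :
    Omega N *ᵥ spinWeight ψ = magnetization ψ := by
  funext n
  have h2 : (inner ℂ ψ (sigmaZ M n ψ)).re = ∫ x, (inner ℂ (ψ x) (sigmaZ M n ψ x)).re := by
    rw [L2.inner_def]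
    exact (integral_re (L2.integrable_inner (𝕜 := ℂ) ψ (sigmaZ M n ψ))).symm
  rw [magnetization, h2, Matrix.mulVec, dotProduct]
  simp only [spinWeight, ← integral_const_mul]
  rw [← integral_finsetSum _ fun α _ => (integrable_norm_sq_component ψ α).const_mul _]
  refine integral_congr_ae ?_
  filter_upwards [coeFn_sigmaZ n ψ] with x hx
  rw [PiLp.inner_apply, Complex.re_sum]
  refine Finset.sum_congr rfl fun α _ => ?_
  have h3 : (inner ℂ (ψ x α) (ψ x α)).re = ‖ψ x α‖ ^ 2 :=
    inner_self_eq_norm_sq (𝕜 := ℂ) (ψ x α)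
  have h4 : inner ℂ (ψ x α) (((Omega N n α : ℝ) : ℂ) * ψ x α) =
      ((Omega N n α : ℝ) : ℂ) * inner ℂ (ψ x α) (ψ x α) := inner_smul_right _ _ _
  rw [hx, h4, Complex.re_ofReal_mul, h3]

/-- An affine function vanishing on a set of full affine span is zero. -/
theorem affine_eq_zero {c : ℝ} {a : Fin N → ℝ} {s : Set (Fin N → ℝ)}
    (hs : affineSpan ℝ s = ⊤) (h : ∀ y ∈ s, c + a ⬝ᵥ y = 0) : c = 0 ∧ a = 0 := by
  have hall : ∀ y, c + a ⬝ᵥ y = 0 := fun y => by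
    have hy : y ∈ affineSpan ℝ s := hs ▸ AffineSubspace.mem_top ℝ _ y
    refine affineSpan_induction (p := fun y => c + a ⬝ᵥ y = 0) hy h ?_
    intro r u v w hu hv hw
    simp only [vsub_eq_sub, vadd_eq_add, dotProduct_add, dotProduct_smul, dotProduct_sub,
      smul_eq_mul]
    linear_combination r * hu - r * hv + hw
  have hc : c = 0 := by simpa using hall 0
  refine ⟨hc, ?_⟩
  have := hall a
  rw [hc, zero_add] at this
  exact dotProduct_self_eq_zero.1 this

/-- The zero set is either empty or a translate of the kernel of a nonzero functional, hence a
proper affine subspace. -/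
theorem volume_affine_hyperplane {b : Fin M → ℝ} (hb : b ≠ 0) (c : ℝ) :
    (volume : Measure (Pos M)) {x | c + ∑ m, b m * x m = 0} = 0 := by
  let l : Pos M →ₗ[ℝ] ℝ := ∑ m, b m • (EuclideanSpace.proj (𝕜 := ℝ) m : Pos M →L[ℝ] ℝ).toLinearMap
  have hl : ∀ x, l x = ∑ m, b m * x m := fun x => by simp [l]
  by_cases hne : ∃ x₀ : Pos M, c + ∑ m, b m * x₀ m = 0
  · obtain ⟨x₀, hx₀⟩ := hne
    have hset : {x : Pos M | c + ∑ m, b m * x m = 0} = (AffineSubspace.mk' x₀ (LinearMap.ker l)) := by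
      ext x
      simp only [Set.mem_ofPred_eq, SetLike.mem_coe, AffineSubspace.mem_mk', vsub_eq_sub,
        LinearMap.mem_ker, map_sub]
      rw [hl, hl]
      constructor <;> intro h <;> linarith
    rw [hset]
    refine Measure.addHaar_affineSubspace _ _ fun htop => hb ?_
    have hk : LinearMap.ker l = ⊤ := by
      rw [← AffineSubspace.direction_mk' x₀ (LinearMap.ker l), htop, AffineSubspace.direction_top]
    funext m
    have : l (EuclideanSpace.single m 1) = 0 := by
      rw [LinearMap.ker_eq_top.1 hk]; rfl
    rw [hl] at this
    simpa using this
  · push Not at hne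
    have : {x : Pos M | c + ∑ m, b m * x m = 0} = ∅ := by
      ext x; simpa using hne x
    rw [this, measure_empty]

/-- At a regular magnetization, the vectors `ψ`, `σ_z^n ψ`, `x_m ψ` are linearly independent
over the reals. -/
theorem constraint_independent {σ : Fin N → ℝ} (hσ : IsRegular σ) {ψ : Q₀ M N}
    (hnorm : ‖(ψ : Hilb M N)‖ = 1) (hmag : magnetization (ψ : Hilb M N) = σ)
    {c : ℝ} {a : Fin N → ℝ} {b : Fin M → ℝ}
    (h : (c : ℂ) • (ψ : Hilb M N) + ∑ n, (a n : ℂ) • sigmaZ M n (ψ : Hilb M N) +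
      ∑ m, (b m : ℂ) • xQ m ψ = 0) : c = 0 ∧ a = 0 ∧ b = 0 := by
  -- All the operators involved are diagonal in `x` and `α`, so the relation becomes a scalar
  -- equation for each component.
  have hpt : ∀ᵐ x ∂(volume : Measure (Pos M)), ∀ α,
      ((c + ∑ n, a n * Omega N n α + ∑ m, b m * x m : ℝ) : ℂ) * (ψ : Hilb M N) x α = 0 := by
    have hz : ∀ᵐ x ∂(volume : Measure (Pos M)), ((c : ℂ) • (ψ : Hilb M N) +
        ∑ n, (a n : ℂ) • sigmaZ M n (ψ : Hilb M N) + ∑ m, (b m : ℂ) • xQ m ψ : Hilb M N) x = 0 := by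
      rw [h]; exact Lp.coeFn_zero _ _ _
    have hall1 : ∀ᵐ x ∂(volume : Measure (Pos M)), ∀ n,
        ((a n : ℂ) • sigmaZ M n (ψ : Hilb M N) : Hilb M N) x =
          (a n : ℂ) • sigmaZ M n (ψ : Hilb M N) x := ae_all_iff.2 fun n => Lp.coeFn_smul _ _
    have hall2 : ∀ᵐ x ∂(volume : Measure (Pos M)), ∀ m,
        ((b m : ℂ) • xQ m ψ : Hilb M N) x = (b m : ℂ) • xQ m ψ x :=
      ae_all_iff.2 fun m => Lp.coeFn_smul _ _
    filter_upwards [hz, hall1, hall2, ae_all_iff.2 fun n => coeFn_sigmaZ n (ψ : Hilb M N),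
      ae_all_iff.2 fun m => coeFn_xQ m ψ, Lp.coeFn_smul (c : ℂ) (ψ : Hilb M N),
      Lp.coeFn_add ((c : ℂ) • (ψ : Hilb M N) + ∑ n, (a n : ℂ) • sigmaZ M n (ψ : Hilb M N))
        (∑ m, (b m : ℂ) • xQ m ψ),
      Lp.coeFn_add ((c : ℂ) • (ψ : Hilb M N)) (∑ n, (a n : ℂ) • sigmaZ M n (ψ : Hilb M N)),
      Lp.coeFn_finsetSum Finset.univ fun n => (a n : ℂ) • sigmaZ M n (ψ : Hilb M N),
      Lp.coeFn_finsetSum Finset.univ fun m => (b m : ℂ) • xQ m ψ]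
      with x hz h1 h2 h3 h4 h5 h6 h7 h8 h9 α
    rw [h6, Pi.add_apply, h7, Pi.add_apply, h8, h9, h5] at hz
    have := congrArg (fun v : Spinor N => v α) hz
    simp only [Finset.sum_apply, h1, h2, h4, Pi.smul_apply, PiLp.add_apply, PiLp.smul_apply,
      smul_eq_mul, PiLp.zero_apply, WithLp.ofLp_sum, h3] at this
    push_cast
    rw [add_mul, add_mul, Finset.sum_mul, Finset.sum_mul]
    simpa only [mul_assoc] using this
  have hψ0 : (ψ : Hilb M N) ≠ 0 := fun h0 => by simp [h0] at hnorm
  have hb : b = 0 := by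
    by_contra hb
    apply hψ0
    refine Lp.eq_zero_iff_ae_eq_zero.2 ?_
    have hne : ∀ᵐ x ∂(volume : Measure (Pos M)), ∀ α : Spin N,
        ¬ (c + ∑ n, a n * Omega N n α + ∑ m, b m * x m = 0) :=
      ae_all_iff.2 fun α => by
        have := volume_affine_hyperplane hb (c + ∑ n, a n * Omega N n α)
        rw [ae_iff]; simpa using this
    filter_upwards [hpt, hne] with x h1 h2
    ext α
    exact (mul_eq_zero.1 (h1 α)).resolve_left (by exact_mod_cast h2 α)
  subst hb
  -- With `b = 0` the scalar factor is constant in `x`, so it must vanish for each `α` whose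
  -- component has nonzero weight.
  have hspan := hσ.2 (spinWeight (ψ : Hilb M N))
    (fun α => integral_nonneg fun x => by positivity)
    (by rw [sum_spinWeight, hnorm]; norm_num) ((Omega_mulVec_spinWeight _).trans hmag)
  obtain ⟨hc, ha⟩ := affine_eq_zero (c := c) (a := a) hspan (by
    rintro _ ⟨α, hα, rfl⟩
    by_contra hne
    apply hα
    rw [spinWeight]
    refine integral_eq_zero_of_ae ?_
    filter_upwards [hpt] with x hx
    have h1 := hx α
    simp only [Pi.zero_apply, zero_mul, Finset.sum_const_zero, add_zero] at h1
    have hne' : ((c + ∑ n, a n * Omega N n α : ℝ) : ℂ) ≠ 0 := by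
      refine Complex.ofReal_ne_zero.2 fun h0 => hne ?_
      simpa [dotProduct, Matrix.mulVec_single] using h0
    simp [(mul_eq_zero.1 h1).resolve_left hne'])
  exact ⟨hc, ha, rfl⟩

/-- The coupling is at most linear in `‖x_m φ‖` and is dominated by `‖x_m φ‖²`; the `σ_x` term is
bounded on unit vectors. Without a lower bound, the real `sInf` would say nothing about the
energies. -/
theorem bddBelow_form₀ (Λ : Matrix (Fin M) (Fin N) ℝ) (t : Fin N → ℝ) (σ : Fin N → ℝ)
    (ξ : Fin M → ℝ) : BddBelow (form₀ Λ t '' constraintSet σ ξ) := by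
  refine ⟨-(∑ m, (∑ n, |Λ m n| * ‖(sigmaZ M n : Hilb M N →L[ℂ] Hilb M N)‖) ^ 2) -
    ∑ n, |t n| * ‖(sigmaX M n : Hilb M N →L[ℂ] Hilb M N)‖, ?_⟩
  rintro _ ⟨φ, ⟨hφ, -, -⟩, rfl⟩
  have hop : ∀ (A : Hilb M N →L[ℂ] Hilb M N) (y : Hilb M N) (r : ℝ),
      |r * (inner ℂ (φ : Hilb M N) (A y)).re| ≤ |r| * ‖A‖ * ‖y‖ := by
    intro A y r
    rw [abs_mul, mul_assoc]
    refine mul_le_mul_of_nonneg_left ?_ (abs_nonneg _)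
    calc |(inner ℂ (φ : Hilb M N) (A y)).re| ≤ ‖(φ : Hilb M N)‖ * ‖A y‖ :=
          (Complex.abs_re_le_norm _).trans (norm_inner_le_norm _ _)
      _ ≤ ‖A‖ * ‖y‖ := by rw [hφ, one_mul]; exact A.le_opNorm y
  have h1 : -(∑ m, (∑ n, |Λ m n| * ‖(sigmaZ M n : Hilb M N →L[ℂ] Hilb M N)‖) ^ 2) ≤
      ∑ m, ‖xQ m φ‖ ^ 2 +
        ∑ m, ∑ n, Λ m n * (inner ℂ (φ : Hilb M N) (sigmaZ M n (xQ m φ))).re := by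
    rw [← Finset.sum_neg_distrib, ← Finset.sum_add_distrib]
    refine Finset.sum_le_sum fun m _ => ?_
    have h2 : -((∑ n, |Λ m n| * ‖(sigmaZ M n : Hilb M N →L[ℂ] Hilb M N)‖) * ‖xQ m φ‖) ≤
        ∑ n, Λ m n * (inner ℂ (φ : Hilb M N) (sigmaZ M n (xQ m φ))).re := by
      rw [Finset.sum_mul, ← Finset.sum_neg_distrib]
      exact Finset.sum_le_sum fun n _ => (abs_le.1 (hop (sigmaZ M n) (xQ m φ) (Λ m n))).1
    -- The minimum of `r² - C r` is `-C² / 4`; the cruder `-C²` suffices.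
    nlinarith [sq_nonneg (‖xQ m φ‖ - ∑ n, |Λ m n| * ‖(sigmaZ M n : Hilb M N →L[ℂ] Hilb M N)‖),
      sq_nonneg (‖xQ m φ‖), sq_nonneg (∑ n, |Λ m n| * ‖(sigmaZ M n : Hilb M N →L[ℂ] Hilb M N)‖)]
  have h3 : ∑ n, t n * (inner ℂ (φ : Hilb M N) (sigmaX M n (φ : Hilb M N))).re ≤
      ∑ n, |t n| * ‖(sigmaX M n : Hilb M N →L[ℂ] Hilb M N)‖ := by
    refine Finset.sum_le_sum fun n _ => ?_
    have := (abs_le.1 (hop (sigmaX M n) (φ : Hilb M N) (t n))).2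
    rwa [hφ, mul_one] at this
  have h4 : 0 ≤ ∑ m, ‖dQ m φ‖ ^ 2 := Finset.sum_nonneg fun m _ => by positivity
  rw [form₀]
  linarith

end Constraints

/-! ### Graphs of sums of unbounded operators -/

section Graph

variable {E : Type*} [AddCommGroup E] [Module ℂ E]

/-- Graph membership records domain and value together, so nested sums need no transport between
domain subtypes. -/
theorem mem_graph_add {f g : E →ₗ.[ℂ] E} {x a b : E} (hf : (x, a) ∈ f.graph)
    (hg : (x, b) ∈ g.graph) : (x, a + b) ∈ (f + g).graph := by
  rw [LinearPMap.mem_graph_iff] at hf hg ⊢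
  obtain ⟨⟨x, hx⟩, rfl, rfl⟩ := hf
  obtain ⟨⟨y, hy⟩, h1, rfl⟩ := hg
  obtain rfl : y = x := h1
  exact ⟨⟨y, hx, hy⟩, rfl, rfl⟩

theorem mem_graph_neg {f : E →ₗ.[ℂ] E} {x a : E} (hf : (x, a) ∈ f.graph) :
    (x, -a) ∈ (-f).graph := by
  rw [LinearPMap.mem_graph_iff] at hf ⊢
  obtain ⟨⟨x, hx⟩, rfl, rfl⟩ := hf
  exact ⟨⟨x, hx⟩, rfl, rfl⟩

theorem mem_graph_sub {f g : E →ₗ.[ℂ] E} {x a b : E} (hf : (x, a) ∈ f.graph)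
    (hg : (x, b) ∈ g.graph) : (x, a - b) ∈ (f - g).graph := by
  rw [sub_eq_add_neg, sub_eq_add_neg]
  exact mem_graph_add hf (mem_graph_neg hg)

theorem mem_graph_smul {f : E →ₗ.[ℂ] E} {x a : E} (c : ℂ) (hf : (x, a) ∈ f.graph) :
    (x, c • a) ∈ (c • f).graph := by
  rw [LinearPMap.mem_graph_iff] at hf ⊢
  obtain ⟨⟨x, hx⟩, rfl, rfl⟩ := hf
  exact ⟨⟨x, hx⟩, rfl, rfl⟩

theorem mem_graph_sum {ι : Type*} (s : Finset ι) {f : ι → E →ₗ.[ℂ] E} {x : E} {a : ι → E}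
    (h : ∀ i ∈ s, (x, a i) ∈ (f i).graph) : (x, ∑ i ∈ s, a i) ∈ (∑ i ∈ s, f i).graph := by
  classical
  induction s using Finset.induction_on with
  | empty =>
    rw [Finset.sum_empty, Finset.sum_empty, LinearPMap.mem_graph_iff]
    -- The empty sum is the zero operator with domain `⊤`, so it imposes no domain condition.
    exact ⟨⟨x, trivial⟩, rfl, rfl⟩
  | insert i s hi ih =>
    rw [Finset.sum_insert hi, Finset.sum_insert hi]
    exact mem_graph_add (h i (Finset.mem_insert_self _ _))
      (ih fun k hk => h k (Finset.mem_insert_of_mem hk))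

theorem mem_graph_toPMap (A : E →ₗ[ℂ] E) (x : E) : (x, A x) ∈ (A.toPMap ⊤).graph :=
  LinearPMap.mem_graph_iff _ |>.2 ⟨⟨x, trivial⟩, rfl, rfl⟩

end Graph

/-! ### The quadratic forms as bilinear forms -/

section Optimality

variable {M N : ℕ}

/-- The weak derivative as a linear map on the form domain. -/
def dQₗ (m : Fin M) : Q₀ M N →ₗ[ℂ] Hilb M N where
  toFun := dQ m
  map_add' := dQ_add m
  map_smul' := dQ_smul m

/-- The coordinate multiplication as a linear map on the form domain. -/
def xQₗ (m : Fin M) : Q₀ M N →ₗ[ℂ] Hilb M N where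
  toFun := xQ m
  map_add' := xQ_add m
  map_smul' := xQ_smul m

theorem real_smul_eq (c : ℝ) (ψ : Q₀ M N) : c • ψ = (c : ℂ) • ψ :=
  RCLike.real_smul_eq_coe_smul (K := ℂ) c ψ

/-- The real bilinear form `Re ⟨S ψ, T χ⟩`. -/
def reForm (S T : Q₀ M N →ₗ[ℂ] Hilb M N) : LinearMap.BilinForm ℝ (Q₀ M N) :=
  LinearMap.mk₂ ℝ (fun ψ χ => (inner ℂ (S ψ) (T χ)).re)
    (fun ψ ψ' χ => by rw [map_add, inner_add_left, Complex.add_re])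
    (fun c ψ χ => by
      rw [real_smul_eq, map_smul, inner_smul_left, Complex.conj_ofReal,
        Complex.re_ofReal_mul, smul_eq_mul])
    (fun ψ χ χ' => by rw [map_add, inner_add_right, Complex.add_re])
    (fun c ψ χ => by
      rw [real_smul_eq, map_smul, inner_smul_right, Complex.re_ofReal_mul, smul_eq_mul])

theorem reForm_apply (S T : Q₀ M N →ₗ[ℂ] Hilb M N) (ψ χ : Q₀ M N) :
    reForm S T ψ χ = (inner ℂ (S ψ) (T χ)).re := rfl

/-- The bilinear form of `H₀`. -/
def bilin₀ (Λ : Matrix (Fin M) (Fin N) ℝ) (t : Fin N → ℝ) : LinearMap.BilinForm ℝ (Q₀ M N) :=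
  ∑ m, reForm (dQₗ m) (dQₗ m) + ∑ m, reForm (xQₗ m) (xQₗ m)
    + ∑ m, ∑ n, Λ m n • reForm (Q₀ M N).subtype ((sigmaZ M n).toLinearMap ∘ₗ xQₗ m)
    - ∑ n, t n • reForm (Q₀ M N).subtype ((sigmaX M n).toLinearMap ∘ₗ (Q₀ M N).subtype)

theorem bilin₀_apply (Λ : Matrix (Fin M) (Fin N) ℝ) (t : Fin N → ℝ) (ψ χ : Q₀ M N) :
    bilin₀ Λ t ψ χ = ∑ m, (inner ℂ (dQ m ψ) (dQ m χ)).re + ∑ m, (inner ℂ (xQ m ψ) (xQ m χ)).re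
      + ∑ m, ∑ n, Λ m n * (inner ℂ (ψ : Hilb M N) (sigmaZ M n (xQ m χ))).re
      - ∑ n, t n * (inner ℂ (ψ : Hilb M N) (sigmaX M n (χ : Hilb M N))).re := by
  simp only [bilin₀, LinearMap.sub_apply, LinearMap.add_apply, LinearMap.sum_apply,
    LinearMap.smul_apply, reForm_apply, smul_eq_mul]
  rfl

theorem bilin₀_self (Λ : Matrix (Fin M) (Fin N) ℝ) (t : Fin N → ℝ) (ψ : Q₀ M N) :
    bilin₀ Λ t ψ ψ = form₀ Λ t ψ := by
  have h : ∀ a : Hilb M N, (inner ℂ a a).re = ‖a‖ ^ 2 := fun a => inner_self_eq_norm_sq (𝕜 := ℂ) a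
  simp only [bilin₀_apply, form₀, h]

theorem re_inner_symm (a b : Hilb M N) : (inner ℂ a b).re = (inner ℂ b a).re :=
  inner_re_symm (𝕜 := ℂ) a b

theorem re_inner_sigmaZ (n : Fin N) (a b : Hilb M N) :
    (inner ℂ (sigmaZ M n a) b).re = (inner ℂ a (sigmaZ M n b)).re :=
  congrArg Complex.re (inner_spinOp (isHermitian_lift isHermitian_pauliZ n) a b)

theorem re_inner_sigmaX (n : Fin N) (a b : Hilb M N) :
    (inner ℂ (sigmaX M n a) b).re = (inner ℂ a (sigmaX M n b)).re :=
  congrArg Complex.re (inner_spinOp (isHermitian_lift isHermitian_pauliX n) a b)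

theorem re_inner_xQ (m : Fin M) (ψ χ : Q₀ M N) :
    (inner ℂ (xQ m ψ) (χ : Hilb M N)).re = (inner ℂ (ψ : Hilb M N) (xQ m χ)).re :=
  congrArg Complex.re (inner_xQ m ψ χ)

theorem re_inner_sigmaZ_xQ (n : Fin N) (m : Fin M) (ψ χ : Q₀ M N) :
    (inner ℂ (sigmaZ M n (xQ m ψ)) (χ : Hilb M N)).re =
      (inner ℂ (ψ : Hilb M N) (sigmaZ M n (xQ m χ))).re :=
  congrArg Complex.re (inner_spinOp_xQ (isHermitian_lift isHermitian_pauliZ n) m ψ χ)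

theorem bilin₀_symm (Λ : Matrix (Fin M) (Fin N) ℝ) (t : Fin N → ℝ) (ψ χ : Q₀ M N) :
    bilin₀ Λ t ψ χ = bilin₀ Λ t χ ψ := by
  rw [bilin₀_apply, bilin₀_apply]
  refine congrArg₂ (· - ·) (congrArg₂ (· + ·) (congrArg₂ (· + ·) ?_ ?_) ?_) ?_
  · exact Finset.sum_congr rfl fun m _ => re_inner_symm _ _
  · exact Finset.sum_congr rfl fun m _ => re_inner_symm _ _
  · refine Finset.sum_congr rfl fun m _ => Finset.sum_congr rfl fun n _ => ?_
    rw [← re_inner_sigmaZ_xQ, re_inner_symm]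
  · refine Finset.sum_congr rfl fun n _ => ?_
    rw [← re_inner_sigmaX, re_inner_symm]

/-- The bilinear forms of the constraints `‖ψ‖²`, `σ_ψ` and `ξ_ψ`. -/
def constraintForm : Unit ⊕ Fin N ⊕ Fin M → LinearMap.BilinForm ℝ (Q₀ M N)
  | .inl _ => reForm (Q₀ M N).subtype (Q₀ M N).subtype
  | .inr (.inl n) => reForm (Q₀ M N).subtype ((sigmaZ M n).toLinearMap ∘ₗ (Q₀ M N).subtype)
  | .inr (.inr m) => reForm (Q₀ M N).subtype (xQₗ m)

theorem constraintForm_symm (i : Unit ⊕ Fin N ⊕ Fin M) (ψ χ : Q₀ M N) :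
    constraintForm i ψ χ = constraintForm i χ ψ := by
  rcases i with _ | n | m
  · exact re_inner_symm _ _
  · exact (re_inner_sigmaZ n _ _).symm.trans (re_inner_symm _ _)
  · exact (re_inner_xQ m ψ χ).symm.trans (re_inner_symm _ _)

theorem sum_constraintForm (l : Unit ⊕ Fin N ⊕ Fin M → ℝ) (ψ χ : Q₀ M N) :
    ∑ i, l i * constraintForm i ψ χ =
      l (.inl ()) * (inner ℂ (ψ : Hilb M N) (χ : Hilb M N)).re
        + ∑ n, l (.inr (.inl n)) * (inner ℂ (ψ : Hilb M N) (sigmaZ M n (χ : Hilb M N))).re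
        + ∑ m, l (.inr (.inr m)) * (inner ℂ (ψ : Hilb M N) (xQ m χ)).re := by
  rw [Fintype.sum_sum_type, Fintype.sum_sum_type, ← add_assoc]
  simp only [Finset.univ_unique, Finset.sum_singleton]
  rfl

/-- Symmetry moves `σ_z^n` and `x_m` onto `ψ`, turning a relation among the functionals into one
among vectors of `L²`. -/
theorem constraintForm_independent {σ : Fin N → ℝ} (hσ : IsRegular σ) {ψ : Q₀ M N}
    (hnorm : ‖(ψ : Hilb M N)‖ = 1) (hmag : magnetization (ψ : Hilb M N) = σ)
    (c : Unit ⊕ Fin N ⊕ Fin M → ℝ) (hc : ∀ χ, ∑ i, c i * constraintForm i ψ χ = 0) : c = 0 := by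
  have h := eq_zero_of_re_inner_Q₀
    (h := ((c (.inl ()) : ℝ) : ℂ) • (ψ : Hilb M N)
      + ∑ n, ((c (.inr (.inl n)) : ℝ) : ℂ) • sigmaZ M n (ψ : Hilb M N)
      + ∑ m, ((c (.inr (.inr m)) : ℝ) : ℂ) • xQ m ψ) fun χ => by
    have := hc χ
    rw [sum_constraintForm] at this
    simp only [inner_add_left, sum_inner, inner_smul_left, Complex.conj_ofReal, Complex.add_re,
      Complex.re_sum, Complex.re_ofReal_mul, re_inner_sigmaZ, re_inner_xQ]
    exact this
  obtain ⟨h1, h2, h3⟩ := constraint_independent hσ hnorm hmag h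
  funext i
  rcases i with _ | n | m
  · exact h1
  · exact congrFun h2 n
  · exact congrFun h3 m

/-- The graph of `H(v, j)` at vectors solving the equation `(-Δ + |x|²) u = f`. -/
theorem mem_graph_H (Λ : Matrix (Fin M) (Fin N) ℝ) (t v : Fin N → ℝ) (j : Fin M → ℝ)
    (u : Q₀ M N) (f : Hilb M N)
    (hweak : ∀ χ : Q₀ M N, ∑ m, (inner ℂ (dQ m u) (dQ m χ)).re +
      ∑ m, (inner ℂ (xQ m u) (xQ m χ)).re = (inner ℂ f (χ : Hilb M N)).re) :
    ((u : Hilb M N), f + ∑ m, ∑ n, ((Λ m n : ℝ) : ℂ) • sigmaZ M n (xQ m u)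
      - ∑ n, ((t n : ℝ) : ℂ) • sigmaX M n (u : Hilb M N)
      + ∑ n, ((v n : ℝ) : ℂ) • sigmaZ M n (u : Hilb M N)
      + ∑ m, ((j m : ℝ) : ℂ) • xQ m u) ∈ (H Λ t v j).graph := by
  obtain ⟨h₁, h₂, hf⟩ := strong_of_weak u f hweak
  have hx : ∀ m, ((u : Hilb M N), xQ m u) ∈ (coord N m).graph := fun m =>
    LinearPMap.mem_graph (coord N m) ⟨u, ((Submodule.mem_iInf _).1 u.2 m).2⟩
  rw [← hf]
  refine mem_graph_add (mem_graph_add (mem_graph_sub (mem_graph_add (mem_graph_add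
    (mem_graph_neg (LinearPMap.mem_graph (laplace M N) ⟨(u : Hilb M N), h₁⟩))
    (LinearPMap.mem_graph (mulOp M N fun x => ‖x‖ ^ 2) ⟨(u : Hilb M N), h₂⟩))
    (mem_graph_sum _ fun m _ => mem_graph_sum _ fun n _ => mem_graph_smul _ ?_))
    (mem_graph_sum _ fun n _ => mem_graph_smul _ (mem_graph_toPMap _ _)))
    (mem_graph_sum _ fun n _ => mem_graph_smul _ (mem_graph_toPMap _ _)))
    (mem_graph_sum _ fun m _ => mem_graph_smul _ (hx m))
  exact LinearPMap.mem_graph_iff _ |>.2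
    ⟨⟨u, ((Submodule.mem_iInf _).1 u.2 m).2⟩, rfl, rfl⟩

end Optimality

end Dicke

end

/-! ### The optimality theorem -/

theorem theorem3p8 {M N : ℕ} (Λ : Matrix (Fin M) (Fin N) ℝ) (t : Fin N → ℝ) (ht : t ≠ 0)
    (σ : Fin N → ℝ) (ξ : Fin M → ℝ) (hσ : Dicke.IsRegular σ)
    (ψ : Dicke.Q₀ M N) (hψ : ψ ∈ Dicke.constraintSet σ ξ)
    (hopt : Dicke.form₀ Λ t ψ = Dicke.FLL Λ t σ ξ) :
    ∃ (E : ℝ) (v : Fin N → ℝ) (j : Fin M → ℝ),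
      (∃ hdom : (ψ : Dicke.Hilb M N) ∈ (Dicke.H Λ t v j).domain,
        Dicke.H Λ t v j ⟨ψ, hdom⟩ = (E : ℂ) • (ψ : Dicke.Hilb M N)) ∧
      (∀ χ ∈ Dicke.tangentSpace ψ,
        E * ‖(χ : Dicke.Hilb M N)‖ ^ 2 ≤ Dicke.form Λ t v j χ) ∧
      Dicke.FLL Λ t σ ξ = Dicke.form₀ Λ t ψ ∧
      Dicke.form₀ Λ t ψ = E - v ⬝ᵥ σ - j ⬝ᵥ ξ := by
  open Dicke in
  obtain ⟨hnorm, hmag, hdis⟩ := id hψ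
  have hself : ∀ a : Hilb M N, (inner ℂ a a).re = ‖a‖ ^ 2 := fun a =>
    inner_self_eq_norm_sq (𝕜 := ℂ) a
  obtain ⟨l, hl1, hl2⟩ := exists_multipliers (bilin₀ Λ t) (bilin₀_symm Λ t) constraintForm
    constraintForm_symm ψ (constraintForm_independent hσ hnorm hmag) fun φ hφ => by
      rw [bilin₀_self, bilin₀_self, hopt]
      refine csInf_le (bddBelow_form₀ Λ t σ ξ) ⟨φ, ⟨?_, ?_, ?_⟩, rfl⟩
      · have h : (inner ℂ (φ : Hilb M N) (φ : Hilb M N)).re =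
          (inner ℂ (ψ : Hilb M N) (ψ : Hilb M N)).re := hφ (.inl ())
        rw [hself, hself, hnorm] at h
        exact (sq_eq_sq₀ (norm_nonneg _) zero_le_one).1 h
      · rw [← hmag]
        exact funext fun n => hφ (.inr (.inl n))
      · rw [← hdis]
        exact funext fun m => hφ (.inr (.inr m))
  simp only [sum_constraintForm, hself] at hl1 hl2
  -- The signs of `v` and `j` flip because the potentials move to the operator side of the
  -- multiplier identity.
  refine ⟨l (.inl ()), fun n => -l (.inr (.inl n)), fun m => -l (.inr (.inr m)), ?_, ?_,
    hopt.symm, ?_⟩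
  -- The right side `f` is `E ψ` minus every term of `H(v, j) ψ` other than `(-Δ + |x|²) ψ`, so the
  -- graph value collapses to `E ψ`. The weak equation required for this `f` is `hl1`.
  · have hgraph := mem_graph_H Λ t (fun n => -l (.inr (.inl n))) (fun m => -l (.inr (.inr m))) ψ
      (((l (.inl ()) : ℝ) : ℂ) • (ψ : Hilb M N)
        - ∑ m, ∑ n, ((Λ m n : ℝ) : ℂ) • sigmaZ M n (xQ m ψ)
        + ∑ n, ((t n : ℝ) : ℂ) • sigmaX M n (ψ : Hilb M N)
        - ∑ n, (((-l (.inr (.inl n))) : ℝ) : ℂ) • sigmaZ M n (ψ : Hilb M N)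
        - ∑ m, (((-l (.inr (.inr m))) : ℝ) : ℂ) • xQ m ψ) fun χ => by
      have h := hl1 χ
      rw [bilin₀_apply] at h
      simp only [inner_add_left, inner_sub_left, sum_inner, inner_smul_left, Complex.conj_ofReal,
        Complex.add_re, Complex.sub_re, Complex.re_sum, Complex.re_ofReal_mul, re_inner_sigmaZ_xQ]
      simp only [re_inner_sigmaZ, re_inner_sigmaX, re_inner_xQ, neg_mul, Finset.sum_neg_distrib]
      linarith
    obtain ⟨⟨y, hy⟩, rfl, hHy⟩ := (LinearPMap.mem_graph_iff _).1 hgraph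
    refine ⟨hy, hHy.trans ?_⟩
    dsimp only
    abel
  · rintro χ ⟨h1, h2, h3⟩
    have h := hl2 χ (by
      rintro (_ | n | m)
      · exact h1
      · exact (re_inner_sigmaZ n _ _).symm.trans (h2 n)
      · exact (re_inner_xQ m ψ χ).symm.trans (h3 m))
    rw [bilin₀_self] at h
    simp only [form, dotProduct, magnetization, displacement, neg_mul, Finset.sum_neg_distrib]
    linarith
  -- Taking `χ = ψ`, the constraint values turn the multiplier identity into the formula for the
  -- energy.
  · have h := hl1 ψ
    rw [bilin₀_self, hself, hnorm] at h
    rw [h, ← hmag, ← hdis]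
    simp only [dotProduct, magnetization, displacement, neg_mul, Finset.sum_neg_distrib]
    ring
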